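/- Let $\mathcal H$ be a real separable Hilbert space (for instance $L^2(\mathcal Z,\nu)$) with inner product $\langle\cdot,\cdot\rangle$ and norm $\|\cdot\|$; write $\|\cdot\|$ also for the operator norm, and $(v\otimes w)(h)=\langle v,h\rangle w$. \textbf{Errors.} Let $\{\varepsilon_i\}_{i\in\mathbb Z}$ be a centered, strictly stationary sequence of $\mathcal H$-valued random variables with $\mathsf E\|\varepsilon_1\|^{\kappa}<\infty$ for some $\kappa>2$. Put $C_r=\mathsf E[\varepsilon_0\otimes\varepsilon_r]$ and assume $\sum_{r\in\mathbb Z}\|C_r\|<\infty$ and $C_\varepsilon:=\sum_{r\in\mathbb Z}C_r\neq0$. Let $C_\varepsilon=\sum_{p\ge1}\lambda_p\,v_p\otimes v_p$ be its spectral decomposition, with non-increasing eigenvalues $\lambda_1\ge\lambda_2\ge\dots\ge0$ and orthonormal eigenvectors $v_p$ (for $\lambda_p=0$ the vector $v_p$ may be arbitrary), and assume $\sum_{p\ge1}\sum_{h\in\mathbb Z}|\mathsf{Cov}(\langle\varepsilon_0,v_p\rangle,\langle\varepsilon_h,v_p\rangle)|<\infty$. Assume the functional central limit theorem $$\Big\{\tfrac1{\sqrt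 n}\sum_{i=1}^{\lfloor nt\rfloor}\varepsilon_i,\ t\in[0,1]\Big\}\Longrightarrow\{W(t),\ t\in[0,1]\}$$ weakly in the Skorokhod space $D([0,1],\mathcal H)$, where $W$ is an $\mathcal H$-valued Brownian motion with covariance operator $C_\varepsilon$, i.e. $W(0)=0$, $W$ has continuous paths and independent centered Gaussian increments, and $W(t)-W(s)$ has covariance operator $(t-s)C_\varepsilon$ for $s\le t$. \textbf{Covariance estimator.} Let $\hat C_n$ be random compact self-adjoint operators on $\mathcal H$ with $\|\hat C_n-C_\varepsilon\|\to0$ in probability, and let $\hat\lambda_{1,n}$ be the largest eigenvalue of $\hat C_n$. \textbf{Statistic.} Let $X_i=\mu_i+\varepsilon_i$, $\bar X_n=\frac1n\sum_{i=1}^nX_i$, and $$T_{n,\mathrm{WF}}(\hat C_n)=\max_{1\le k<n}\Big\|(\hat C_n+\hat\lambda_{1,n}\mathrm{Id})^{-1/2}\,\frac1{\sqrt n}\sum_{i=1}^k(X_i-\bar X_n)\Big\|,$$ where $A^{-1/2}$ is the unique positive definite operator $R$ with $RAR=\mathrm{Id}$ (set to $0$ if there is none). \textbf{Claim.} Under the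 null hypothesis $H_0$ that $\mu_1=\mu_2=\dots$, as $n\to\infty$, $$T^2_{n,\mathrm{WF}}(\hat C_n)\ \overset{\mathcal D}{\longrightarrow}\ \sup_{0\le t\le1}\ \sum_{p=1}^\infty\frac{\lambda_p}{\lambda_p+\lambda_1}\,B_p^2(t),$$ where $B_1,B_2,\dots$ are independent standard Brownian bridges on $[0,1]$. The limit is almost surely well defined: with probability one the series converges for every $t\in[0,1]$ and the supremum is finite. -/

import Mathlib

open MeasureTheory ProbabilityTheory Filter Topology Set
open scoped ENNReal NNReal RealInnerProductSpace unitInterval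

noncomputable section

/-! ### The Skorokhod space `D([0,1], E)` -/

/-- A function on `[0,1]` is càdlàg: right continuous with left limits. -/
def IsCadlag {E : Type*} [TopologicalSpace E] (f : I → E) : Prop :=
  ∀ t : I, ContinuousWithinAt f (Ici t) t ∧ ∃ l : E, Tendsto f (𝓝[<] t) (𝓝 l)

/-- The space of càdlàg functions `[0,1] → E`. -/
def SkorokhodSpace (E : Type*) [TopologicalSpace E] : Type _ := {f : I → E // IsCadlag f}

namespace SkorokhodSpace

instance {E : Type*} [TopologicalSpace E] : CoeFun (SkorokhodSpace E) (fun _ => I → E) :=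
  ⟨fun f => f.1⟩

/-- The size of a time change `e` (an increasing bijection of `[0,1]`) as a comparison of the
paths `x` and `y`: the maximum of `sup_t |e t - t|` and `sup_t d(x t, y (e t))`. -/
def timeChangeCost {E : Type*} [PseudoEMetricSpace E] (x y : SkorokhodSpace E) (e : I ≃o I) :
    ℝ≥0∞ :=
  max (⨆ t : I, edist (e t) t) (⨆ t : I, edist (x t) (y (e t)))

theorem timeChangeCost_symm_le {E : Type*} [PseudoEMetricSpace E] (x y : SkorokhodSpace E)
    (e : I ≃o I) : timeChangeCost y x e.symm ≤ timeChangeCost x y e := by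
  unfold timeChangeCost
  refine max_le_max (iSup_le fun t => ?_) (iSup_le fun t => ?_)
  · refine le_iSup_of_le (e.symm t) ?_
    rw [e.apply_symm_apply, edist_comm]
  · refine le_iSup_of_le (e.symm t) ?_
    rw [e.apply_symm_apply, edist_comm]

theorem timeChangeCost_trans_le {E : Type*} [PseudoEMetricSpace E] (x y z : SkorokhodSpace E)
    (e e' : I ≃o I) :
    timeChangeCost x z (e.trans e') ≤ timeChangeCost x y e + timeChangeCost y z e' := by
  refine max_le (iSup_le fun t => ?_) (iSup_le fun t => ?_)
  · calc edist (e.trans e' t) t ≤ edist (e' (e t)) (e t) + edist (e t) t := edist_triangle _ _ _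
      _ = edist (e t) t + edist (e' (e t)) (e t) := add_comm _ _
      _ ≤ _ := add_le_add
        (le_max_of_le_left (le_iSup (fun s : I => edist (e s) s) t))
        (le_max_of_le_left (le_iSup (fun s : I => edist (e' s) s) (e t)))
  · calc edist (x t) (z (e.trans e' t))
        ≤ edist (x t) (y (e t)) + edist (y (e t)) (z (e' (e t))) := edist_triangle _ _ _
      _ ≤ _ := add_le_add
        (le_max_of_le_right (le_iSup (fun s : I => edist (x s) (y (e s))) t))
        (le_max_of_le_right (le_iSup (fun s : I => edist (y s) (z (e' s))) (e t)))

/-- The Skorokhod `J₁` distance: the infimum over all time changes of the cost above. -/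
instance {E : Type*} [PseudoEMetricSpace E] : PseudoEMetricSpace (SkorokhodSpace E) where
  edist x y := ⨅ e : I ≃o I, timeChangeCost x y e
  edist_self x := by
    refine le_antisymm (iInf_le_of_le (OrderIso.refl I) ?_) zero_le
    simp [timeChangeCost]
  edist_comm x y := le_antisymm
    (le_iInf fun e => iInf_le_of_le e.symm (timeChangeCost_symm_le y x e))
    (le_iInf fun e => iInf_le_of_le e.symm (timeChangeCost_symm_le x y e))
  edist_triangle x y z := by
    rw [ENNReal.iInf_add]
    refine le_iInf fun e => ?_
    rw [ENNReal.add_iInf]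
    exact le_iInf fun e' => iInf_le_of_le (e.trans e') (timeChangeCost_trans_le x y z e e')

instance {E : Type*} [PseudoEMetricSpace E] : MeasurableSpace (SkorokhodSpace E) :=
  borel (SkorokhodSpace E)

instance {E : Type*} [PseudoEMetricSpace E] : BorelSpace (SkorokhodSpace E) := ⟨rfl⟩

end SkorokhodSpace

theorem isCadlag_comp_floor {E : Type*} [TopologicalSpace E] (n : ℕ) (g : ℕ → E) :
    IsCadlag (fun t : I => g ⌊(n : ℝ) * t⌋₊) := by
  intro t
  have hcont : Tendsto (fun u : I => (n : ℝ) * u) (𝓝 t) (𝓝 ((n : ℝ) * t)) :=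
    (continuous_const.mul continuous_subtype_val).tendsto t
  have key : ∀ (l : Filter I) (m : ℤ),
      Tendsto (fun u : I => ⌊(n : ℝ) * u⌋) l (pure m) →
      Tendsto (fun u : I => g ⌊(n : ℝ) * u⌋₊) l (𝓝 (g m.toNat)) := by
    intro l m h
    refine tendsto_nhds_of_eventually_eq ?_
    filter_upwards [tendsto_pure.1 h] with u hu
    rw [← Int.floor_toNat, hu]
  constructor
  · have h : Tendsto (fun u : I => (n : ℝ) * u) (𝓝[≥] t) (𝓝[≥] ((n : ℝ) * t)) := by
      refine tendsto_nhdsWithin_iff.2 ⟨hcont.mono_left nhdsWithin_le_nhds, ?_⟩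
      filter_upwards [self_mem_nhdsWithin] with u hu
      exact mul_le_mul_of_nonneg_left (show (t : ℝ) ≤ u from hu) (Nat.cast_nonneg n)
    have := key _ _ ((tendsto_floor_right_pure_floor _).comp h)
    rw [Int.floor_toNat] at this
    exact this
  · rcases Nat.eq_zero_or_pos n with rfl | hn
    · exact ⟨g 0, by simpa using tendsto_const_nhds⟩
    · have h : Tendsto (fun u : I => (n : ℝ) * u) (𝓝[<] t) (𝓝[<] ((n : ℝ) * t)) := by
        refine tendsto_nhdsWithin_iff.2 ⟨hcont.mono_left nhdsWithin_le_nhds, ?_⟩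
        filter_upwards [self_mem_nhdsWithin] with u hu
        exact mul_lt_mul_of_pos_left (show (u : ℝ) < t from hu) (Nat.cast_pos.2 hn)
      exact ⟨_, key _ _ ((tendsto_floor_left_pure_ceil_sub_one _).comp h)⟩

/-- The partial sum process `t ↦ n^{-1/2} ∑_{i=1}^{⌊nt⌋} x_i`, as an element of `D([0,1], H)`. -/
def partialSumProcess {H : Type*} [NormedAddCommGroup H] [NormedSpace ℝ H] (n : ℕ) (x : ℤ → H) :
    SkorokhodSpace H :=
  ⟨fun t => (√(n : ℝ))⁻¹ • ∑ i ∈ Finset.Icc 1 ⌊(n : ℝ) * t⌋₊, x (i : ℤ),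
    isCadlag_comp_floor n (fun k => (√(n : ℝ))⁻¹ • ∑ i ∈ Finset.Icc 1 k, x (i : ℤ))⟩

/-! ### Covariance operators, Brownian motion and Brownian bridges -/

section Hilbert

variable {H : Type*} [NormedAddCommGroup H] [InnerProductSpace ℝ H] [CompleteSpace H]
  {Ω : Type*} [MeasurableSpace Ω]

/-- `E[X ⊗ Y]`, where `(v ⊗ w)(h) = ⟪v, h⟫ w`. -/
def crossCovOp (P : Measure Ω) (X Y : Ω → H) : H →L[ℝ] H :=
  ∫ ω, InnerProductSpace.rankOne ℝ (Y ω) (X ω) ∂P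

/-- The lag-`r` covariance operator `C_r = E[ε_0 ⊗ ε_r]`. -/
def lagCovOp (P : Measure Ω) (ε : ℤ → Ω → H) (r : ℤ) : H →L[ℝ] H := crossCovOp P (ε 0) (ε r)

/-- The long-run covariance operator `∑_{r ∈ ℤ} C_r` (a sum in operator norm). -/
def longRunCovOp (P : Measure Ω) (ε : ℤ → Ω → H) : H →L[ℝ] H := ∑' r : ℤ, lagCovOp P ε r

/-- `C = ∑_p lam p • (v p ⊗ v p)` (in operator norm) with non-increasing eigenvalues and
orthonormal eigenvectors. The vectors `v p` with `lam p = 0` do not contribute and are left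
unconstrained, so that operators of finite rank, operators on a finite-dimensional `H`, and
operators having both infinitely many positive eigenvalues and a kernel are all covered. Since
such a sequence `lam` tends to `0`, it is automatically nonnegative, and `lam 0` is the
largest eigenvalue when `C ≠ 0`. -/
structure IsSpectralDecomposition (C : H →L[ℝ] H) (lam : ℕ → ℝ) (v : ℕ → H) : Prop where
  antitone : Antitone lam
  orthonormal : Orthonormal ℝ (fun p : {p : ℕ // lam p ≠ 0} => v p)
  hasSum : HasSum (fun p => lam p • InnerProductSpace.rankOne ℝ (v p) (v p)) C

/-- `W` is an `H`-valued Brownian motion on `[0,1]` with covariance operator `C`: it starts at `0`,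
has continuous paths, and has independent centered Gaussian increments, the covariance operator
of `W t - W s` being `(t - s) C`. -/
structure IsHilbertBrownianMotion [MeasurableSpace H] (C : H →L[ℝ] H) (W : I → Ω → H)
    (P : Measure Ω) : Prop where
  zero : ∀ᵐ ω ∂P, W 0 ω = 0
  continuous_paths : ∀ᵐ ω ∂P, Continuous fun t => W t ω
  indep_increments : HasIndepIncrements W P
  gaussian : ∀ s t : I, s ≤ t → HasGaussianLaw (fun ω => W t ω - W s ω) P
  centered : ∀ s t : I, s ≤ t → ∫ ω, (W t ω - W s ω) ∂P = 0
  covariance : ∀ s t : I, s ≤ t → ∀ x y : H,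
    cov[fun ω => ⟪x, W t ω - W s ω⟫, fun ω => ⟪y, W t ω - W s ω⟫; P] =
      ((t : ℝ) - s) * ⟪C x, y⟫

/-- A standard Brownian bridge on `[0,1]`: a continuous centered Gaussian process with covariance
`min s t - s t`. -/
structure IsBrownianBridge (B : I → Ω → ℝ) (P : Measure Ω) : Prop where
  measurable : ∀ t, Measurable (B t)
  continuous_paths : ∀ᵐ ω ∂P, Continuous fun t => B t ω
  gaussian : IsGaussianProcess B P
  centered : ∀ t, ∫ ω, B t ω ∂P = 0
  covariance : ∀ s t : I, cov[B s, B t; P] = min (s : ℝ) t - s * t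

/-! ### The test statistic -/

/-- The largest eigenvalue of a (compact, self-adjoint) operator. -/
def firstEigenvalue (T : H →L[ℝ] H) : ℝ :=
  sSup {μ : ℝ | Module.End.HasEigenvalue (T : H →ₗ[ℝ] H) μ}

/-- Positive definite bounded self-adjoint operators. -/
def IsPosDefOp (A : H →L[ℝ] H) : Prop := IsSelfAdjoint A ∧ ∀ x : H, x ≠ 0 → 0 < ⟪A x, x⟫

open Classical in
/-- `A^{-1/2}`: the unique positive definite `R` with `R A R = Id` (and `0` if there is none). -/
def invSqrtOp (A : H →L[ℝ] H) : H →L[ℝ] H :=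
  if h : ∃ R : H →L[ℝ] H, IsPosDefOp R ∧ R ∘L A ∘L R = ContinuousLinearMap.id ℝ H
  then h.choose else 0

/-- The sample mean of `x_1, …, x_n`. -/
def sampleMean (n : ℕ) (x : ℕ → H) : H := (n : ℝ)⁻¹ • ∑ i ∈ Finset.Icc 1 n, x i

/-- The weighted functional statistic
`max_{1 ≤ k < n} ‖(T + λ₁(T) Id)^{-1/2} n^{-1/2} ∑_{i=1}^k (x_i - x̄_n)‖`
of the observations `x_1, …, x_n` with the covariance estimate `T`. -/
def weightedStatistic (T : H →L[ℝ] H) (n : ℕ) (x : ℕ → H) : ℝ :=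
  ⨆ k : Finset.Ico 1 n,
    ‖invSqrtOp (T + firstEigenvalue T • ContinuousLinearMap.id ℝ H)
      ((√(n : ℝ))⁻¹ • ∑ i ∈ Finset.Icc 1 (k : ℕ), (x i - sampleMean n x))‖

end Hilbert

end

/-! The proof combines Slutsky's theorem, the continuous mapping theorem and an eigenvector
expansion of the limit. Let C be the long-run covariance operator, λ₁ its largest eigenvalue (`lam
0`), R = (C + λ₁)^{-1/2}, and Z_n the partial sum process of the errors.

Replacing the estimator by C: for self-adjoint coercive A, ‖A^{-1/2} y‖² = ⟪A⁻¹ y, y⟫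
(`norm_sq_invSqrtOp_apply`), so continuity of inversion suffices and continuity of the operator
square root is never needed. A positive largest eigenvalue is the supremum of the quadratic form
(`firstEigenvalue_eq_rayleighSup`), which is 1-Lipschitz in operator norm. Under the null hypothesis
the mean cancels. When the estimator is close to C, the statistic differs from sup_t ‖R(Z_n(t) - t
Z_n(1))‖ by at most a small factor times sup ‖Z_n‖ (`abs_weightedStatistic_sub_bridgeSup_le`), and
sup ‖Z_n‖ is tight by the functional central limit theorem.

Passing to the limit: x ↦ sup_t ‖R(x(t) - t x(1))‖ is continuous for the J₁ distance
(`continuous_bridgeSup`), so the statistic converges in law to this functional of W.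

Identifying the law: at each time the bridge W(t) - t W(1) is almost surely orthogonal to ker C, so
it expands in the eigenvectors with nonzero eigenvalue, and ‖R ·‖² of it is ∑ (λ_p + λ₁)⁻¹ ⟪v_p, ·⟫²
(`hasSum_norm_sq`). Divided by √λ_p, the coordinates are centered Gaussian with the covariances of
independent Brownian bridges. Along a dense sequence of times, both suprema are one measurable
function of countable Gaussian families with equal laws. The same transfer shows that the series of
bridges is almost surely finite. -/

noncomputable section

/-! ### Quadratic forms and the largest eigenvalue -/

section Operators

variable {H : Type*} [NormedAddCommGroup H] [InnerProductSpace ℝ H]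

/-- The supremum of the quadratic form `⟪T x, x⟫` over the unit sphere. -/
def rayleighSup (T : H →L[ℝ] H) : ℝ := ⨆ x : Metric.sphere (0 : H) 1, ⟪T x, (x : H)⟫

theorem real_inner_apply_self_le (T : H →L[ℝ] H) (x : H) : |⟪T x, x⟫| ≤ ‖T‖ * ‖x‖ ^ 2 :=
  (abs_real_inner_le_norm _ _).trans <| by
    rw [pow_two, ← mul_assoc]
    gcongr
    exact T.le_opNorm x

theorem bddAbove_rayleigh (T : H →L[ℝ] H) :
    BddAbove (range fun x : Metric.sphere (0 : H) 1 => ⟪T x, (x : H)⟫) := by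
  refine ⟨‖T‖, ?_⟩
  rintro _ ⟨x, rfl⟩
  have h := (le_abs_self _).trans (real_inner_apply_self_le T x)
  simpa [norm_eq_of_mem_sphere x] using h

theorem inner_le_rayleighSup (T : H →L[ℝ] H) (x : H) : ⟪T x, x⟫ ≤ rayleighSup T * ‖x‖ ^ 2 := by
  rcases eq_or_ne x 0 with rfl | hx
  · simp
  have hx' : 0 < ‖x‖ := norm_pos_iff.2 hx
  have h := le_ciSup (bddAbove_rayleigh T) ⟨‖x‖⁻¹ • x, by simp [norm_smul, hx'.ne']⟩
  simp only [map_smul, real_inner_smul_left, real_inner_smul_right] at h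
  change _ ≤ rayleighSup T at h
  have h2 : ‖x‖⁻¹ * (‖x‖⁻¹ * ⟪T x, x⟫) * ‖x‖ ^ 2 ≤ rayleighSup T * ‖x‖ ^ 2 := by gcongr
  refine le_trans (le_of_eq ?_) h2
  field_simp

theorem rayleighSup_le [Nontrivial H] {T : H →L[ℝ] H} {c : ℝ}
    (h : ∀ x : H, ‖x‖ = 1 → ⟪T x, x⟫ ≤ c) : rayleighSup T ≤ c := by
  have : Nonempty (Metric.sphere (0 : H) 1) :=
    (NormedSpace.sphere_nonempty.2 zero_le_one).to_subtype
  exact ciSup_le fun x => h x (norm_eq_of_mem_sphere x)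

theorem lipschitzWith_rayleighSup [Nontrivial H] :
    LipschitzWith 1 (rayleighSup : (H →L[ℝ] H) → ℝ) := by
  refine LipschitzWith.of_le_add fun S T => rayleighSup_le fun x hx => ?_
  have h1 := inner_le_rayleighSup T x
  have h2 := (le_abs_self _).trans (real_inner_apply_self_le (S - T) x)
  rw [hx] at h1 h2
  rw [dist_eq_norm]
  have : ⟪(S - T) x, x⟫ = ⟪S x, x⟫ - ⟪T x, x⟫ := by simp [inner_sub_left]
  linarith

theorem IsSelfAdjoint.inner_apply_comm [CompleteSpace H] {T : H →L[ℝ] H} (hT : IsSelfAdjoint T)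
    (x y : H) : ⟪T x, y⟫ = ⟪x, T y⟫ :=
  (ContinuousLinearMap.isSelfAdjoint_iff_isSymmetric.1 hT) x y

/-- Nonnegativity of the form at `x - N⁻¹ • S x`, one gradient step away from `x`, plays the role of
the Cauchy–Schwarz inequality for the form. The `+ 1` keeps `N` invertible when `S = 0`. -/
theorem norm_sq_apply_le_of_nonneg [CompleteSpace H] {S : H →L[ℝ] H} (hS : IsSelfAdjoint S)
    (h : ∀ x, 0 ≤ ⟪S x, x⟫) (x : H) : ‖S x‖ ^ 2 ≤ (‖S‖ + 1) * ⟪S x, x⟫ := by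
  set N := ‖S‖ + 1
  have hN : 0 < N := by positivity
  have h0 := h (x - N⁻¹ • S x)
  have h1 : ⟪S (S x), S x⟫ ≤ N * ‖S x‖ ^ 2 :=
    (le_abs_self _).trans ((real_inner_apply_self_le S (S x)).trans (by gcongr; simp [N]))
  have h2 : ⟪S (x - N⁻¹ • S x), x - N⁻¹ • S x⟫ =
      ⟪S x, x⟫ - 2 * N⁻¹ * ‖S x‖ ^ 2 + N⁻¹ * (N⁻¹ * ⟪S (S x), S x⟫) := by
    simp only [map_sub, map_smul, inner_sub_left, inner_sub_right, real_inner_smul_left,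
      real_inner_smul_right, hS.inner_apply_comm (S x) x, real_inner_self_eq_norm_sq]
    ring
  have h3 : N⁻¹ * (N⁻¹ * ⟪S (S x), S x⟫) ≤ N⁻¹ * (N⁻¹ * (N * ‖S x‖ ^ 2)) := by gcongr
  have h4 : N⁻¹ * (N⁻¹ * (N * ‖S x‖ ^ 2)) = N⁻¹ * ‖S x‖ ^ 2 := by field_simp
  have h5 : N⁻¹ * ‖S x‖ ^ 2 ≤ ⟪S x, x⟫ := by linarith
  calc ‖S x‖ ^ 2 = N * (N⁻¹ * ‖S x‖ ^ 2) := by field_simp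
    _ ≤ _ := by gcongr

/-- If the supremum were not an eigenvalue, compactness would make `T - rayleighSup T` bounded
below. But `S = rayleighSup T - T` has a nonnegative form, so a near-maximizer `x` has small `⟪S x,
x⟫` and therefore small `S x`. Positivity matters: for a compact operator a supremum equal to zero
need not be an eigenvalue. -/
theorem hasEigenvalue_rayleighSup [CompleteSpace H] {T : H →L[ℝ] H} (hT : IsSelfAdjoint T)
    (hc : IsCompactOperator T) (hpos : 0 < rayleighSup T) :
    Module.End.HasEigenvalue (T : H →ₗ[ℝ] H) (rayleighSup T) := by
  by_contra hne
  have hnt : Nonempty (Metric.sphere (0 : H) 1) := by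
    by_contra hE
    rw [not_nonempty_iff] at hE
    simp [rayleighSup] at hpos
  obtain ⟨K, hK⟩ := hc.antilipschitz_of_not_hasEigenvalue hpos.ne' hne
  set S : H →L[ℝ] H := rayleighSup T • 1 - T with hSdef
  have hS : IsSelfAdjoint S := by
    refine IsSelfAdjoint.sub ?_ hT
    exact (IsSelfAdjoint.all (rayleighSup T)).smul (IsSelfAdjoint.one _)
  have hSx : ∀ x, ⟪S x, x⟫ = rayleighSup T * ‖x‖ ^ 2 - ⟪T x, x⟫ := fun x => by
    simp [hSdef, inner_sub_left, real_inner_smul_left]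
  have hnn : ∀ x, 0 ≤ ⟪S x, x⟫ := fun x => by
    rw [hSx]; linarith [inner_le_rayleighSup T x]
  have hlow : ∀ x : H, ‖x‖ ≤ K * ‖S x‖ := fun x => by
    have h := hK.le_mul_dist x 0
    rw [dist_zero_right, map_zero, dist_zero_right] at h
    rwa [show S x = -((T - rayleighSup T • 1 : H →L[ℝ] H) x) by simp [hSdef], norm_neg]
  -- With this `L`, a unit vector maximizing the form up to `L⁻¹` yields `1 ≤ (L - 1) / L`, which is
  -- absurd.
  set L : ℝ := (K : ℝ) ^ 2 * (‖S‖ + 1) + 1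
  have hL : 0 < L := by positivity
  obtain ⟨x, hx⟩ := exists_lt_of_lt_ciSup (show rayleighSup T - L⁻¹ < ⨆ x : Metric.sphere (0 : H) 1,
    ⟪T x, (x : H)⟫ by change _ < rayleighSup T; linarith [inv_pos.2 hL])
  have hx1 : ‖(x : H)‖ = 1 := norm_eq_of_mem_sphere x
  have h1 := norm_sq_apply_le_of_nonneg hS hnn x
  have h2 : ⟪S x, (x : H)⟫ < L⁻¹ := by rw [hSx, hx1]; linarith
  have h3 := hlow x
  rw [hx1] at h3
  have h4 : (1 : ℝ) ≤ (K : ℝ) ^ 2 * ‖S x‖ ^ 2 := by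
    rw [← mul_pow]; exact one_le_pow₀ h3
  have h5 : (K : ℝ) ^ 2 * ‖S x‖ ^ 2 ≤ (K : ℝ) ^ 2 * ((‖S‖ + 1) * L⁻¹) := by
    gcongr
    exact h1.trans (by gcongr)
  have h6 : (K : ℝ) ^ 2 * ((‖S‖ + 1) * L⁻¹) = (L - 1) * L⁻¹ := by simp [L]; ring
  rw [h6, sub_mul, mul_inv_cancel₀ hL.ne'] at h5
  linarith [inv_pos.2 hL]

theorem eigenvalue_le_rayleighSup {T : H →L[ℝ] H} {a : ℝ}
    (h : Module.End.HasEigenvalue (T : H →ₗ[ℝ] H) a) : a ≤ rayleighSup T := by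
  obtain ⟨x, hx⟩ := h.exists_hasEigenvector
  have h1 : T x = a • x := hx.apply_eq_smul
  have h2 := inner_le_rayleighSup T x
  rw [h1, real_inner_smul_left, real_inner_self_eq_norm_sq] at h2
  exact le_of_mul_le_mul_right h2 (by have := norm_pos_iff.2 hx.2; positivity)

theorem firstEigenvalue_eq_rayleighSup [CompleteSpace H] {T : H →L[ℝ] H} (hT : IsSelfAdjoint T)
    (hc : IsCompactOperator T) (hpos : 0 < rayleighSup T) : firstEigenvalue T = rayleighSup T :=
  IsGreatest.csSup_eq ⟨hasEigenvalue_rayleighSup hT hc hpos, fun _ h => eigenvalue_le_rayleighSup h⟩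

theorem firstEigenvalue_nonpos {T : H →L[ℝ] H} (h : rayleighSup T ≤ 0) : firstEigenvalue T ≤ 0 :=
  Real.sSup_nonpos fun _ ha => (eigenvalue_le_rayleighSup ha).trans h

/-! ### Shifting by the largest value of the quadratic form -/

/-- The operators `T` for which `T + rayleighSup T` is coercive and `0 < rayleighSup T`. -/
def coerciveShiftSet (H : Type*) [NormedAddCommGroup H] [InnerProductSpace ℝ H] :
    Set (H →L[ℝ] H) := {T | 0 < rayleighSup T ∧ rayleighSup (-T) < rayleighSup T}

theorem isOpen_coerciveShiftSet [Nontrivial H] : IsOpen (coerciveShiftSet H) := by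
  have h : Continuous (rayleighSup : (H →L[ℝ] H) → ℝ) := lipschitzWith_rayleighSup.continuous
  exact (isOpen_lt continuous_const h).inter (isOpen_lt (h.comp continuous_neg) h)

/-- On the unit sphere the form of `T` is bounded below by `-rayleighSup (-T)`. The estimators are
not assumed nonnegative, so coercivity of the shift is a genuine condition on them. It is an open
one that holds at the limit operator. -/
theorem coercive_of_mem_coerciveShiftSet (T : H →L[ℝ] H) (x : H) :
    (rayleighSup T - rayleighSup (-T)) * ‖x‖ ^ 2 ≤
      ⟪(T + rayleighSup T • ContinuousLinearMap.id ℝ H) x, x⟫ := by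
  have h1 := inner_le_rayleighSup (-T) x
  simp only [_root_.neg_apply, inner_neg_left] at h1
  simp only [_root_.add_apply, _root_.smul_apply, ContinuousLinearMap.id_apply, inner_add_left,
    real_inner_smul_left, real_inner_self_eq_norm_sq]
  linarith

/-- The inverse of `T + rayleighSup T`. -/
def invShift (T : H →L[ℝ] H) : H →L[ℝ] H :=
  Ring.inverse (T + rayleighSup T • ContinuousLinearMap.id ℝ H)

open Classical in
/-- `‖(T + λ₁(T))^{-1/2} y‖`, expressed through the inverse of `T + λ₁(T)`. -/
def shiftNorm (y : H) (T : H →L[ℝ] H) : ℝ :=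
  (coerciveShiftSet H).piecewise (fun T => √⟪invShift T y, y⟫) (fun _ => 0) T

open Classical in
theorem shiftNorm_of_mem {T : H →L[ℝ] H} (h : T ∈ coerciveShiftSet H) (y : H) :
    shiftNorm y T = √⟪invShift T y, y⟫ := piecewise_eq_of_mem _ _ _ h

open Classical in
theorem shiftNorm_of_notMem {T : H →L[ℝ] H} (h : T ∉ coerciveShiftSet H) (y : H) :
    shiftNorm y T = 0 := piecewise_eq_of_notMem _ _ _ h

theorem continuous_shiftNorm (T : H →L[ℝ] H) : Continuous fun y => shiftNorm y T := by
  by_cases h : T ∈ coerciveShiftSet H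
  · simp only [shiftNorm_of_mem h]
    fun_prop
  · simp only [shiftNorm_of_notMem h]
    fun_prop

theorem abs_sqrt_sub_sqrt_le (a b : ℝ) : |√a - √b| ≤ √|a - b| := by
  have key : ∀ a b : ℝ, √a - √b ≤ √|a - b| := fun a b => by
    have h : √a ≤ √(b + |a - b|) := Real.sqrt_le_sqrt (by linarith [le_abs_self (a - b)])
    have h2 : √(b + |a - b|) ≤ √b + √|a - b| := by
      rcases le_total 0 b with hb | hb
      · refine Real.sqrt_le_left (by positivity) |>.2 ?_
        nlinarith [Real.sq_sqrt hb, Real.sq_sqrt (abs_nonneg (a - b)), Real.sqrt_nonneg b,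
          Real.sqrt_nonneg |a - b|, mul_nonneg (Real.sqrt_nonneg b) (Real.sqrt_nonneg |a - b|)]
      · rw [Real.sqrt_eq_zero_of_nonpos hb, zero_add]
        exact Real.sqrt_le_sqrt (by linarith)
    linarith
  refine abs_sub_le_iff.2 ⟨key a b, ?_⟩
  rw [abs_sub_comm]
  exact key b a

theorem abs_shiftNorm_sub_le {S T : H →L[ℝ] H} (hS : S ∈ coerciveShiftSet H)
    (hT : T ∈ coerciveShiftSet H) (y : H) :
    |shiftNorm y S - shiftNorm y T| ≤ √‖invShift S - invShift T‖ * ‖y‖ := by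
  rw [shiftNorm_of_mem hS, shiftNorm_of_mem hT]
  refine (abs_sqrt_sub_sqrt_le _ _).trans ?_
  rw [Real.sqrt_le_left (by positivity), mul_pow, Real.sq_sqrt (norm_nonneg _), ← inner_sub_left]
  exact real_inner_apply_self_le (invShift S - invShift T) y

/-! ### Square roots of coercive operators -/

variable [CompleteSpace H]

/-- The equation `(1 - Y)² = 1 - K` is the fixed point equation `Y = (K + Y²) / 2`. Its right-hand
side is a contraction with constant `‖K‖` on the self-adjoint operators of norm at most `‖K‖`. -/
theorem exists_one_sub_sq_eq_one_sub {K : H →L[ℝ] H} (hK : IsSelfAdjoint K) (hK1 : ‖K‖ < 1) :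
    ∃ Y : H →L[ℝ] H, IsSelfAdjoint Y ∧ ‖Y‖ ≤ ‖K‖ ∧ (1 - Y) * (1 - Y) = 1 - K := by
  set s : Set (H →L[ℝ] H) := {Y | IsSelfAdjoint Y} ∩ Metric.closedBall 0 ‖K‖ with hs
  set f : (H →L[ℝ] H) → (H →L[ℝ] H) := fun Y => (2⁻¹ : ℝ) • (K + Y * Y) with hf
  have hsc : IsComplete s := by
    refine (IsClosed.inter ?_ Metric.isClosed_closedBall).isComplete
    exact isClosed_eq continuous_star continuous_id
  have hmaps : MapsTo f s s := by
    rintro Y ⟨hY, hYn⟩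
    have hY' : IsSelfAdjoint Y := hY
    refine ⟨?_, ?_⟩
    · refine (IsSelfAdjoint.all (2⁻¹ : ℝ)).smul (hK.add ?_)
      change star (Y * Y) = Y * Y
      rw [star_mul, hY'.star_eq]
    · rw [mem_closedBall_zero_iff] at hYn ⊢
      have h1 : ‖Y * Y‖ ≤ ‖K‖ * 1 := (norm_mul_le _ _).trans (by gcongr; linarith)
      have h2 := norm_add_le K (Y * Y)
      rw [hf, norm_smul]
      norm_num
      linarith
  have hcontr : ContractingWith ‖K‖₊ (hmaps.restrict f s s) := by
    refine ⟨by exact_mod_cast hK1, LipschitzWith.of_dist_le_mul ?_⟩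
    rintro ⟨Y, hY, hYn⟩ ⟨Z, hZ, hZn⟩
    rw [mem_closedBall_zero_iff] at hYn hZn
    change dist (f Y) (f Z) ≤ ‖K‖ * dist Y Z
    rw [dist_eq_norm, dist_eq_norm]
    have h1 : f Y - f Z = (2⁻¹ : ℝ) • (Y * (Y - Z) + (Y - Z) * Z) := by
      simp only [hf, ← smul_sub]
      congr 1
      noncomm_ring
    have h2 := norm_add_le (Y * (Y - Z)) ((Y - Z) * Z)
    have h3 : ‖Y * (Y - Z)‖ ≤ ‖K‖ * ‖Y - Z‖ := (norm_mul_le _ _).trans (by gcongr)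
    have h4 : ‖(Y - Z) * Z‖ ≤ ‖Y - Z‖ * ‖K‖ := (norm_mul_le _ _).trans (by gcongr)
    rw [h1, norm_smul]
    norm_num
    linarith
  obtain ⟨Y, hYs, hYf, -⟩ := hcontr.exists_fixedPoint' hsc hmaps
    (x := 0) ⟨IsSelfAdjoint.zero _, by simp⟩ (edist_ne_top _ _)
  refine ⟨Y, hYs.1, by simpa using hYs.2, ?_⟩
  have h : K + Y * Y = Y + Y := by
    have h1 : f Y = Y := hYf
    have h2 : (2 : ℝ) • f Y = K + Y * Y := by simp [hf, smul_smul]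
    rw [← h2, h1, two_smul]
  have : (1 - Y) * (1 - Y) = 1 - (Y + Y) + Y * Y := by noncomm_ring
  rw [this, ← h]
  abel

theorem exists_isPosDefOp_sq_eq {B : H →L[ℝ] H} (hB : IsSelfAdjoint B) {m : ℝ} (hm : 0 < m)
    (h : ∀ x, m * ‖x‖ ^ 2 ≤ ⟪B x, x⟫) : ∃ R : H →L[ℝ] H, IsPosDefOp R ∧ R * R = B := by
  set N := ‖B‖ + m + 1 with hN
  have hNpos : 0 < N := by positivity
  -- This `t` minimizes `1 - 2 t m + t² N²`, a bound for `‖1 - t • B‖²`. The minimum is `1 - (m /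
  -- N)² < 1`, so the square root of `t • B = 1 - K` comes from the fixed point argument.
  set t := m / N ^ 2 with ht
  have htpos : 0 < t := by positivity
  have hmN : m / N ≤ 1 := by rw [div_le_one hNpos]; linarith [norm_nonneg B]
  set K : H →L[ℝ] H := 1 - t • B with hKdef
  have hK : IsSelfAdjoint K := (IsSelfAdjoint.one _).sub ((IsSelfAdjoint.all t).smul hB)
  have hq : 0 ≤ 1 - (m / N) ^ 2 := by
    have : (m / N) ^ 2 ≤ 1 := pow_le_one₀ (by positivity) hmN
    linarith
  have hK1 : ‖K‖ < 1 := by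
    refine lt_of_le_of_lt (K.opNorm_le_bound (Real.sqrt_nonneg (1 - (m / N) ^ 2)) fun x => ?_) ?_
    · refine le_of_sq_le_sq ?_ (by positivity)
      rw [mul_pow, Real.sq_sqrt hq]
      have h1 : ‖K x‖ ^ 2 = ‖x‖ ^ 2 - 2 * t * ⟪B x, x⟫ + t ^ 2 * ‖B x‖ ^ 2 := by
        simp only [hKdef, _root_.sub_apply, one_apply_eq_self,
          _root_.smul_apply]
        rw [norm_sub_sq_real, real_inner_smul_right, norm_smul, mul_pow, Real.norm_eq_abs, sq_abs,
          real_inner_comm]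
        ring
      have h2 : ‖B x‖ ^ 2 ≤ N ^ 2 * ‖x‖ ^ 2 := by
        rw [← mul_pow]
        gcongr
        exact (B.le_opNorm x).trans (by gcongr; linarith)
      have h3 : 2 * t * (m * ‖x‖ ^ 2) ≤ 2 * t * ⟪B x, x⟫ := by gcongr; exact h x
      have h4 : t ^ 2 * ‖B x‖ ^ 2 ≤ t ^ 2 * (N ^ 2 * ‖x‖ ^ 2) := by gcongr
      have h5 : t ^ 2 * (N ^ 2 * ‖x‖ ^ 2) = (m / N) ^ 2 * ‖x‖ ^ 2 := by
        rw [ht]; field_simp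
      have h6 : 2 * t * (m * ‖x‖ ^ 2) = 2 * ((m / N) ^ 2 * ‖x‖ ^ 2) := by
        rw [ht]; field_simp
      rw [h1]
      linarith
    · rw [Real.sqrt_lt' one_pos]
      have : 0 < (m / N) ^ 2 := by positivity
      linarith
  obtain ⟨Y, hY, hYK, hYeq⟩ := exists_one_sub_sq_eq_one_sub hK hK1
  refine ⟨(√t)⁻¹ • (1 - Y), ⟨(IsSelfAdjoint.all _).smul ((IsSelfAdjoint.one _).sub hY), ?_⟩, ?_⟩
  · intro x hx
    have hx' : 0 < ‖x‖ := norm_pos_iff.2 hx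
    have h1 := (le_abs_self _).trans (real_inner_apply_self_le Y x)
    have h2 : ‖Y‖ * ‖x‖ ^ 2 < 1 * ‖x‖ ^ 2 := by gcongr; linarith
    simp only [_root_.smul_apply, _root_.sub_apply,
      one_apply_eq_self, real_inner_smul_left, inner_sub_left,
      real_inner_self_eq_norm_sq]
    have : 0 < √t := Real.sqrt_pos.2 htpos
    have : 0 < ‖x‖ ^ 2 - ⟪Y x, x⟫ := by linarith
    positivity
  · rw [smul_mul_smul_comm, hYeq, hKdef, ← mul_inv, Real.mul_self_sqrt htpos.le]
    rw [sub_sub_cancel, smul_smul, inv_mul_cancel₀ htpos.ne', one_smul]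

theorem isUnit_of_coercive {A : H →L[ℝ] H} {c : ℝ} (hc : 0 < c)
    (h : ∀ x, c * ‖x‖ ^ 2 ≤ ⟪A x, x⟫) : IsUnit A :=
  ContinuousLinearMap.isUnit_of_forall_le_norm_inner_map A (c := ⟨c, hc.le⟩) hc fun x => by
    rw [mul_comm]; exact (h x).trans (le_abs_self _)

/-- A square root of `A⁻¹` provides one admissible `R`. Conversely, any `R` with `R A R = 1` has `R
A` as left inverse and `A R` as right inverse, so it commutes with `A` and `R² = A⁻¹`. Hence the
formula holds for whichever `R` is chosen, and uniqueness is not needed. -/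
theorem norm_sq_invSqrtOp_apply {A : H →L[ℝ] H} (hA : IsSelfAdjoint A) {c : ℝ} (hc : 0 < c)
    (h : ∀ x, c * ‖x‖ ^ 2 ≤ ⟪A x, x⟫) (y : H) :
    ‖invSqrtOp A y‖ ^ 2 = ⟪Ring.inverse A y, y⟫ := by
  have hu := isUnit_of_coercive hc h
  have hAB : A * Ring.inverse A = 1 := Ring.mul_inverse_cancel A hu
  have hBA : Ring.inverse A * A = 1 := Ring.inverse_mul_cancel A hu
  have hApp : ∀ x, A (Ring.inverse A x) = x := fun x => by
    rw [← mul_apply_eq_comp, hAB, one_apply_eq_self]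
  have hB : IsSelfAdjoint (Ring.inverse A) := by
    rw [ContinuousLinearMap.isSelfAdjoint_iff_isSymmetric]
    intro x y
    change ⟪Ring.inverse A x, y⟫ = ⟪x, Ring.inverse A y⟫
    conv_lhs => rw [← hApp y]
    rw [← hA.inner_apply_comm, hApp]
  have hex : ∃ R : H →L[ℝ] H, IsPosDefOp R ∧ R ∘L A ∘L R = ContinuousLinearMap.id ℝ H := by
    have hN : 0 < ‖A‖ + 1 := by positivity
    obtain ⟨R, hR, hRR⟩ := exists_isPosDefOp_sq_eq hB (m := c / (‖A‖ + 1) ^ 2) (by positivity)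
      fun x => by
        have h1 : ‖x‖ ≤ (‖A‖ + 1) * ‖Ring.inverse A x‖ := by
          conv_lhs => rw [← hApp x]
          exact (A.le_opNorm _).trans (by gcongr; linarith)
        have h2 := h (Ring.inverse A x)
        rw [hApp, real_inner_comm] at h2
        refine le_trans ?_ h2
        rw [div_mul_eq_mul_div, div_le_iff₀ (by positivity), mul_assoc, ← mul_pow]
        gcongr
        rwa [mul_comm]
    refine ⟨R, hR, ?_⟩
    have hRA : R * (R * A) = 1 := by rw [← mul_assoc, hRR, hBA]
    have hAR : (A * R) * R = 1 := by rw [mul_assoc, hRR, hAB]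
    have h1 : A * R = R * A := (left_inv_eq_right_inv hAR hRA)
    change R * (A * R) = 1
    rw [h1, hRA]
  have hspec := hex.choose_spec
  have hdef : invSqrtOp A = hex.choose := by rw [invSqrtOp, dif_pos hex]
  set R := hex.choose
  rw [hdef]
  obtain ⟨⟨hRsa, -⟩, hRAR⟩ := hspec
  have hRAR' : R * (A * R) = 1 := hRAR
  have hR2 : (R * A) * R = 1 := by rw [mul_assoc, hRAR']
  have hcomm : R * A = A * R := by
    have := left_inv_eq_right_inv hR2 hRAR'
    exact this
  have hRR : R * R = Ring.inverse A := by
    have h1 : (R * R) * A = 1 := by rw [mul_assoc, hcomm, hRAR']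
    calc R * R = (R * R) * (A * Ring.inverse A) := by rw [hAB, mul_one]
      _ = _ := by rw [← mul_assoc, h1, one_mul]
  rw [← hRR, mul_apply_eq_comp, hRsa.inner_apply_comm, real_inner_self_eq_norm_sq]

/-- This is the converse direction: an inverse square root forces coercivity. Where the shifted
operator is not coercive, `invSqrtOp` therefore takes its default value `0`, matching `shiftNorm`
there. -/
theorem coercive_of_exists_invSqrt {A R : H →L[ℝ] H} (hR : IsPosDefOp R)
    (hRAR : R ∘L A ∘L R = ContinuousLinearMap.id ℝ H) (y : H) :
    ‖y‖ ^ 2 ≤ ‖R‖ ^ 2 * ⟪A y, y⟫ := by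
  have hc : ∀ x, R (A (R x)) = x := fun x => by
    simpa using congrArg (fun S : H →L[ℝ] H => S x) hRAR
  obtain ⟨z, rfl⟩ : ∃ z, R z = y := ⟨A (R y), hc y⟩
  rw [← hR.1.inner_apply_comm, hc, real_inner_self_eq_norm_sq, ← mul_pow]
  gcongr
  exact R.le_opNorm z

theorem isSelfAdjoint_shift {T : H →L[ℝ] H} (hT : IsSelfAdjoint T) (c : ℝ) :
    IsSelfAdjoint (T + c • ContinuousLinearMap.id ℝ H) :=
  hT.add ((IsSelfAdjoint.all c).smul (IsSelfAdjoint.one (H →L[ℝ] H)))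

theorem continuousOn_invShift [Nontrivial H] : ContinuousOn invShift (coerciveShiftSet H) := by
  intro T hT
  obtain ⟨u, hu⟩ := isUnit_of_coercive (sub_pos.2 hT.2) (coercive_of_mem_coerciveShiftSet T)
  have h1 : ContinuousAt (fun T : H →L[ℝ] H => T + rayleighSup T • ContinuousLinearMap.id ℝ H) T :=
    (continuous_id.add ((lipschitzWith_rayleighSup.continuous).smul continuous_const)).continuousAt
  have h2 := NormedRing.inverse_continuousAt u
  rw [hu] at h2
  exact (ContinuousAt.comp (f := fun T : H →L[ℝ] H =>
    T + rayleighSup T • ContinuousLinearMap.id ℝ H) (g := Ring.inverse) h2 h1).continuousWithinAt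

theorem norm_invSqrtOp_rayleigh_shift {T : H →L[ℝ] H} (hT : IsSelfAdjoint T)
    (h : T ∈ coerciveShiftSet H) (y : H) :
    ‖invSqrtOp (T + rayleighSup T • ContinuousLinearMap.id ℝ H) y‖ = shiftNorm y T := by
  rw [shiftNorm_of_mem h, invShift,
    ← norm_sq_invSqrtOp_apply (isSelfAdjoint_shift hT _) (sub_pos.2 h.2)
      (coercive_of_mem_coerciveShiftSet T), Real.sqrt_sq (norm_nonneg _)]

theorem norm_invSqrtOp_shift [Nontrivial H] {T : H →L[ℝ] H} (hT : IsSelfAdjoint T)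
    (hc : IsCompactOperator T) (y : H) :
    ‖invSqrtOp (T + firstEigenvalue T • ContinuousLinearMap.id ℝ H) y‖ = shiftNorm y T := by
  by_cases h : T ∈ coerciveShiftSet H
  · rw [firstEigenvalue_eq_rayleighSup hT hc h.1, norm_invSqrtOp_rayleigh_shift hT h]
  rw [shiftNorm_of_notMem h]
  suffices hne : ¬ ∃ R : H →L[ℝ] H, IsPosDefOp R ∧
      R ∘L (T + firstEigenvalue T • ContinuousLinearMap.id ℝ H) ∘L R =
        ContinuousLinearMap.id ℝ H by
    rw [invSqrtOp, dif_neg hne]; simp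
  rintro ⟨R, hR, hRAR⟩
  have hA : ∀ x : H, ‖x‖ = 1 → 1 ≤ ‖R‖ ^ 2 * (⟪T x, x⟫ + firstEigenvalue T) := fun x hx => by
    have := coercive_of_exists_invSqrt hR hRAR x
    simpa [inner_add_left, real_inner_smul_left, hx] using this
  have hRpos : 0 < ‖R‖ ^ 2 := by
    by_contra h0
    have h00 : ‖R‖ ^ 2 = 0 := le_antisymm (not_lt.1 h0) (sq_nonneg _)
    obtain ⟨x, hx⟩ := exists_norm_eq H zero_le_one
    have := hA x hx
    rw [h00] at this
    linarith
  have hA' : ∀ x : H, ‖x‖ = 1 → (‖R‖ ^ 2)⁻¹ ≤ ⟪T x, x⟫ + firstEigenvalue T := fun x hx => by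
    rw [inv_le_iff_one_le_mul₀' hRpos]
    exact hA x hx
  -- If the form is nonpositive, so is `firstEigenvalue T` (it is `0` when there are no
  -- eigenvalues), and the shifted form cannot be coercive. Otherwise coercivity gives the strict
  -- inequality defining `coerciveShiftSet`.
  rcases le_or_gt (rayleighSup T) 0 with h0 | h0
  · obtain ⟨x, hx⟩ := exists_norm_eq H zero_le_one
    have h1 := inner_le_rayleighSup T x
    rw [hx] at h1
    linarith [hA' x hx, firstEigenvalue_nonpos h0, inv_pos.2 hRpos]
  · refine h ⟨h0, ?_⟩
    rw [firstEigenvalue_eq_rayleighSup hT hc h0] at hA'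
    have : rayleighSup (-T) ≤ rayleighSup T - (‖R‖ ^ 2)⁻¹ := rayleighSup_le fun x hx => by
      simp only [_root_.neg_apply, inner_neg_left]
      linarith [hA' x hx]
    linarith [inv_pos.2 hRpos]

/-- A Carathéodory argument: continuous in the vector, and measurable in the operator as a function
continuous on an open set and zero off it. -/
theorem measurable_shiftNorm [Nontrivial H] [TopologicalSpace.SeparableSpace H]
    [MeasurableSpace H] [BorelSpace H] :
    Measurable fun q : H × (H →L[ℝ] H) => shiftNorm q.1 q.2 := by
  have : SecondCountableTopology H := UniformSpace.secondCountable_of_separable H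
  refine measurable_uncurry_of_continuous_of_measurable (u := fun y T => shiftNorm y T)
    continuous_shiftNorm fun y => ?_
  classical
  refine ContinuousOn.measurable_piecewise ?_ continuousOn_const
    isOpen_coerciveShiftSet.measurableSet
  have h1 := continuousOn_invShift (H := H)
  fun_prop

end Operators

/-! ### Càdlàg paths and continuous functionals on the Skorokhod space -/

theorem IsCadlag.exists_norm_le {E : Type*} [NormedAddCommGroup E] {f : I → E} (hf : IsCadlag f) :
    ∃ K : ℝ, ∀ t, ‖f t‖ ≤ K := by
  have key : ∃ K : ℝ, ∀ t ∈ (univ : Set I), ‖f t‖ ≤ K := by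
    refine isCompact_univ.induction_on (p := fun s => ∃ K : ℝ, ∀ t ∈ s, ‖f t‖ ≤ K)
      ⟨0, by simp⟩ (fun s t hst ⟨K, hK⟩ => ⟨K, fun u hu => hK u (hst hu)⟩) ?_ ?_
    · rintro s t ⟨K, hK⟩ ⟨L, hL⟩
      refine ⟨max K L, ?_⟩
      rintro u (hu | hu)
      · exact (hK u hu).trans (le_max_left _ _)
      · exact (hL u hu).trans (le_max_right _ _)
    · intro t _
      obtain ⟨hr, l, hl⟩ := hf t
      -- A neighborhood of `t` splits into a left part, controlled by the left limit `l`, and a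
      -- right part, controlled by `f t`.
      refine ⟨{u | ‖f u‖ ≤ max (‖l‖ + 1) (‖f t‖ + 1)}, ?_, _, fun u hu => hu⟩
      rw [nhdsWithin_univ, ← nhdsLT_sup_nhdsGE t]
      refine ⟨?_, ?_⟩
      · filter_upwards [hl.norm.eventually_lt_const (lt_add_one _)] with u hu
        exact hu.le.trans (le_max_left _ _)
      · filter_upwards [hr.norm.eventually_lt_const (lt_add_one _)] with u hu
        exact hu.le.trans (le_max_right _ _)
  simpa using key

namespace SkorokhodSpace

variable {H : Type*} [NormedAddCommGroup H]

/-- The supremum norm of a path. -/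
def supNorm (x : SkorokhodSpace H) : ℝ := ⨆ t : I, ‖x t‖

theorem bddAbove_norm (x : SkorokhodSpace H) : BddAbove (range fun t : I => ‖x t‖) := by
  obtain ⟨K, hK⟩ := x.2.exists_norm_le
  exact ⟨K, by rintro _ ⟨t, rfl⟩; exact hK t⟩

theorem norm_le_supNorm (x : SkorokhodSpace H) (t : I) : ‖x t‖ ≤ supNorm x :=
  le_ciSup (bddAbove_norm x) t

theorem exists_timeChange {x y : SkorokhodSpace H} {δ : ℝ} (h : edist x y < ENNReal.ofReal δ) :
    ∃ e : I ≃o I, ∀ t : I, |(e t : ℝ) - t| ≤ δ ∧ ‖x t - y (e t)‖ ≤ δ := by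
  obtain ⟨e, he⟩ := iInf_lt_iff.1 h
  have hδ : 0 < δ := ENNReal.ofReal_pos.1 (zero_le.trans_lt h)
  refine ⟨e, fun t => ⟨?_, ?_⟩⟩
  · have h1 : edist (e t) t ≤ ENNReal.ofReal δ :=
      ((le_iSup (fun t : I => edist (e t) t) t).trans (le_max_left _ _)).trans he.le
    rwa [edist_dist, ENNReal.ofReal_le_ofReal_iff hδ.le] at h1
  · have h1 : edist (x t) (y (e t)) ≤ ENNReal.ofReal δ :=
      ((le_iSup (fun t : I => edist (x t) (y (e t))) t).trans (le_max_right _ _)).trans he.le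
    rwa [edist_dist, ENNReal.ofReal_le_ofReal_iff hδ.le, dist_eq_norm] at h1

/-- The constant may depend on `x`, which is what the bridge requires: a time change alters the term
`t • x 1` by up to `δ * ‖x 1‖`. -/
theorem continuous_of_forall_exists {g : SkorokhodSpace H → ℝ}
    (h : ∀ x, ∃ L : ℝ, 0 < L ∧ ∀ δ y, 0 < δ → edist x y < ENNReal.ofReal δ →
      |g x - g y| ≤ L * δ) : Continuous g := by
  refine continuous_iff_continuousAt.2 fun x => ?_
  obtain ⟨L, hL, hx⟩ := h x
  rw [ContinuousAt, Metric.tendsto_nhds]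
  intro ε hε
  have hpos : 0 < ε / (2 * L) := by positivity
  filter_upwards [Metric.eball_mem_nhds x (ENNReal.ofReal_pos.2 hpos)] with y hy
  rw [Metric.mem_eball, edist_comm] at hy
  rw [dist_comm, Real.dist_eq]
  refine (hx _ y hpos hy).trans_lt ?_
  have : L * (ε / (2 * L)) = ε / 2 := by field_simp
  linarith

theorem continuous_supNorm : Continuous (supNorm : SkorokhodSpace H → ℝ) := by
  refine continuous_of_forall_exists fun x => ⟨1, one_pos, fun δ y hδ hxy => ?_⟩
  obtain ⟨e, he⟩ := exists_timeChange hxy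
  rw [one_mul, abs_sub_le_iff, sub_le_iff_le_add, sub_le_iff_le_add]
  constructor
  · refine ciSup_le fun t => ?_
    linarith [norm_le_supNorm y (e t), norm_le_norm_add_norm_sub' (x t) (y (e t)), (he t).2]
  · refine ciSup_le fun t => ?_
    obtain ⟨s, rfl⟩ := e.surjective t
    linarith [norm_le_supNorm x s, norm_le_norm_add_norm_sub (x s) (y (e s)), (he s).2]

variable [NormedSpace ℝ H]

/-- The bridge `t ↦ x t - t x 1` of a path `x`. -/
def bridge (x : SkorokhodSpace H) (t : I) : H := x t - (t : ℝ) • x 1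

/-- The supremum norm of the image of the bridge of a path under `R`. -/
def bridgeSup (R : H →L[ℝ] H) (x : SkorokhodSpace H) : ℝ := ⨆ t : I, ‖R (bridge x t)‖

theorem norm_bridge_le (x : SkorokhodSpace H) (t : I) : ‖bridge x t‖ ≤ 2 * supNorm x := by
  have h1 : ‖(t : ℝ) • x 1‖ ≤ 1 * supNorm x := by
    rw [norm_smul, Real.norm_of_nonneg t.2.1]
    exact mul_le_mul t.2.2 (norm_le_supNorm x 1) (norm_nonneg _) zero_le_one
  calc ‖bridge x t‖ ≤ ‖x t‖ + ‖(t : ℝ) • x 1‖ := norm_sub_le _ _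
    _ ≤ _ := by linarith [norm_le_supNorm x t]

theorem bddAbove_norm_bridge (R : H →L[ℝ] H) (x : SkorokhodSpace H) :
    BddAbove (range fun t : I => ‖R (bridge x t)‖) := by
  refine ⟨‖R‖ * (2 * supNorm x), ?_⟩
  rintro _ ⟨t, rfl⟩
  exact (R.le_opNorm _).trans (by gcongr; exact norm_bridge_le x t)

theorem norm_bridge_le_bridgeSup (R : H →L[ℝ] H) (x : SkorokhodSpace H) (t : I) :
    ‖R (bridge x t)‖ ≤ bridgeSup R x := le_ciSup (bddAbove_norm_bridge R x) t

theorem continuous_bridgeSup (R : H →L[ℝ] H) : Continuous (bridgeSup R) := by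
  refine continuous_of_forall_exists fun x => ⟨(‖R‖ + 1) * (2 + ‖x 1‖), by positivity,
    fun δ y hδ hxy => ?_⟩
  obtain ⟨e, he⟩ := exists_timeChange hxy
  have key : ∀ t, ‖R (bridge x t) - R (bridge y (e t))‖ ≤ (‖R‖ + 1) * (2 + ‖x 1‖) * δ := by
    intro t
    -- An increasing bijection of `[0,1]` fixes `1`, so the endpoint value is continuous in the `J₁`
    -- distance although evaluation at interior times is not.
    have h1 : ‖x 1 - y 1‖ ≤ δ := by
      have h := (he 1).2
      rwa [show e 1 = 1 from e.map_top] at h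
    have h2 : bridge x t - bridge y (e t) =
        (x t - y (e t)) + ((e t : ℝ) - t) • x 1 - (e t : ℝ) • (x 1 - y 1) := by
      simp only [bridge]; module
    have h3 : ‖(e t : ℝ) • (x 1 - y 1)‖ ≤ 1 * δ := by
      rw [norm_smul, Real.norm_of_nonneg (e t).2.1]
      exact mul_le_mul (e t).2.2 h1 (norm_nonneg _) zero_le_one
    have h4 : ‖((e t : ℝ) - t) • x 1‖ ≤ δ * ‖x 1‖ := by
      rw [norm_smul, Real.norm_eq_abs]; gcongr; exact (he t).1
    have h5 : ‖bridge x t - bridge y (e t)‖ ≤ (2 + ‖x 1‖) * δ := by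
      rw [h2]
      refine (norm_sub_le _ _).trans ?_
      linarith [norm_add_le (x t - y (e t)) (((e t : ℝ) - t) • x 1), (he t).2]
    rw [← map_sub, mul_assoc]
    exact (R.le_opNorm _).trans (by gcongr; linarith)
  rw [abs_sub_le_iff, sub_le_iff_le_add, sub_le_iff_le_add]
  constructor
  · refine ciSup_le fun t => ?_
    linarith [norm_bridge_le_bridgeSup R y (e t), key t,
      norm_le_norm_add_norm_sub' (R (bridge x t)) (R (bridge y (e t)))]
  · refine ciSup_le fun t => ?_
    obtain ⟨s, rfl⟩ := e.surjective t
    linarith [norm_bridge_le_bridgeSup R x s, key s,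
      norm_le_norm_add_norm_sub (R (bridge x s)) (R (bridge y (e s)))]

end SkorokhodSpace

/-! ### The statistic as a functional of the partial sum process -/

section Statistic

variable {H : Type*} [NormedAddCommGroup H] [InnerProductSpace ℝ H]

/-- The centered partial sum `n^{-1/2} (∑_{i ≤ k} e_i - (k/n) ∑_{i ≤ n} e_i)`. -/
def centeredSum (n : ℕ) (e : ℤ → H) (k : ℕ) : H :=
  (√(n : ℝ))⁻¹ • (∑ i ∈ Finset.Icc 1 k, e (i : ℤ) -
    ((k : ℝ) / n) • ∑ i ∈ Finset.Icc 1 n, e (i : ℤ))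

theorem sum_sub_sampleMean_eq {n : ℕ} (hn : 0 < n) {m : H} {x : ℕ → H} {e : ℤ → H}
    (hx : ∀ i, 1 ≤ i → x i = m + e i) (k : ℕ) :
    (√(n : ℝ))⁻¹ • ∑ i ∈ Finset.Icc 1 k, (x i - sampleMean n x) = centeredSum n e k := by
  have hsum : ∀ j : ℕ, ∑ i ∈ Finset.Icc 1 j, x i =
      (j : ℝ) • m + ∑ i ∈ Finset.Icc 1 j, e (i : ℤ) := fun j => by
    rw [Finset.sum_congr rfl fun i hi => hx i (Finset.mem_Icc.1 hi).1, Finset.sum_add_distrib]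
    simp [← Nat.cast_smul_eq_nsmul ℝ]
  have hn' : (n : ℝ) ≠ 0 := by positivity
  rw [centeredSum, Finset.sum_sub_distrib, hsum, sampleMean, hsum]
  simp only [Finset.sum_const, Nat.card_Icc, add_tsub_cancel_right, ← Nat.cast_smul_eq_nsmul ℝ,
    smul_add, smul_smul, inv_mul_cancel₀ hn', one_smul, div_eq_mul_inv]
  congr 1
  abel

theorem partialSumProcess_one (n : ℕ) (e : ℤ → H) :
    partialSumProcess n e 1 = (√(n : ℝ))⁻¹ • ∑ i ∈ Finset.Icc 1 n, e (i : ℤ) := by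
  simp [partialSumProcess]

/-- The statistic centers with weight `⌊n t⌋ / n` and the bridge with weight `t`. The discrepancy is
less than `1 / n`, and it vanishes at the grid points `k / n`. -/
theorem bridge_partialSumProcess (n : ℕ) (e : ℤ → H) (t : I) :
    SkorokhodSpace.bridge (partialSumProcess n e) t = centeredSum n e ⌊(n : ℝ) * t⌋₊ -
      ((t : ℝ) - (⌊(n : ℝ) * t⌋₊ : ℝ) / n) • partialSumProcess n e 1 := by
  rw [SkorokhodSpace.bridge, partialSumProcess_one, centeredSum]
  simp only [partialSumProcess]
  module

theorem centeredSum_zero (n : ℕ) (e : ℤ → H) : centeredSum n e 0 = 0 := by simp [centeredSum]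

theorem centeredSum_self {n : ℕ} (hn : 0 < n) (e : ℤ → H) : centeredSum n e n = 0 := by
  have hn' : (n : ℝ) ≠ 0 := by positivity
  simp [centeredSum, div_self hn']

theorem centeredSum_eq_bridge {n k : ℕ} (hk : k ∈ Finset.Ico 1 n) (e : ℤ → H) :
    ∃ t : I, centeredSum n e k = SkorokhodSpace.bridge (partialSumProcess n e) t := by
  obtain ⟨h1, h2⟩ := Finset.mem_Ico.1 hk
  have hn : (0 : ℝ) < n := by exact_mod_cast Nat.lt_of_lt_of_le h1 h2.le
  have hk' : (k : ℝ) ≤ n := by exact_mod_cast h2.le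
  have hfl : ⌊(n : ℝ) * ((k : ℝ) / n)⌋₊ = k := by rw [mul_div_cancel₀ _ hn.ne', Nat.floor_natCast]
  refine ⟨⟨(k : ℝ) / n, by positivity, (div_le_one hn).2 hk'⟩, ?_⟩
  rw [bridge_partialSumProcess]
  simp only [hfl, sub_self, zero_smul, sub_zero]

variable [CompleteSpace H]

theorem weightedStatistic_eq_iSup_shiftNorm [Nontrivial H] {T : H →L[ℝ] H} (hT : IsSelfAdjoint T)
    (hc : IsCompactOperator T) (n : ℕ) (x : ℕ → H) :
    weightedStatistic T n x = ⨆ k : Finset.Ico 1 n,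
      shiftNorm ((√(n : ℝ))⁻¹ • ∑ i ∈ Finset.Icc 1 (k : ℕ), (x i - sampleMean n x)) T := by
  simp only [weightedStatistic, norm_invSqrtOp_shift hT hc]

theorem weightedStatistic_nonneg (T : H →L[ℝ] H) (n : ℕ) (x : ℕ → H) :
    0 ≤ weightedStatistic T n x := Real.iSup_nonneg fun _ => norm_nonneg _

/-- The statistic is close to a fixed functional of the partial sum process. -/
theorem abs_weightedStatistic_sub_bridgeSup_le [Nontrivial H] {T C : H →L[ℝ] H}
    (hT : IsSelfAdjoint T) (hTc : IsCompactOperator T) (hTs : T ∈ coerciveShiftSet H)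
    (hC : IsSelfAdjoint C) (hCs : C ∈ coerciveShiftSet H) {n : ℕ} (hn : 0 < n) {m : H}
    {x : ℕ → H} {e : ℤ → H} (hx : ∀ i, 1 ≤ i → x i = m + e i) {R : H →L[ℝ] H}
    (hR : R = invSqrtOp (C + rayleighSup C • ContinuousLinearMap.id ℝ H)) :
    |weightedStatistic T n x - SkorokhodSpace.bridgeSup R (partialSumProcess n e)| ≤
      (2 * √‖invShift T - invShift C‖ + ‖R‖ / n) *
        SkorokhodSpace.supNorm (partialSumProcess n e) := by
  set Z := partialSumProcess n e with hZ
  set K := SkorokhodSpace.supNorm Z with hK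
  have hK0 : 0 ≤ K := Real.iSup_nonneg fun _ => norm_nonneg _
  set d := √‖invShift T - invShift C‖ with hd
  have hd0 : 0 ≤ d := Real.sqrt_nonneg _
  have hn' : (0 : ℝ) < n := by exact_mod_cast hn
  have hRn : ∀ y, shiftNorm y C = ‖R y‖ := fun y => by
    rw [hR, norm_invSqrtOp_rayleigh_shift hC hCs]
  have hdiff : ∀ k : Finset.Ico 1 n,
      |shiftNorm (centeredSum n e k) T - ‖R (centeredSum n e k)‖| ≤ 2 * d * K := fun k => by
    obtain ⟨t, ht⟩ := centeredSum_eq_bridge k.2 e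
    rw [← hRn]
    refine (abs_shiftNorm_sub_le hTs hCs _).trans ?_
    have := SkorokhodSpace.norm_bridge_le Z t
    rw [← ht] at this
    calc d * ‖centeredSum n e k‖ ≤ d * (2 * K) := by gcongr
      _ = _ := by ring
  have hstat : weightedStatistic T n x = ⨆ k : Finset.Ico 1 n, shiftNorm (centeredSum n e k) T := by
    rw [weightedStatistic_eq_iSup_shiftNorm hT hTc]
    simp only [sum_sub_sampleMean_eq hn hx]
  have hstat0 := weightedStatistic_nonneg T n x
  have hRK : 0 ≤ ‖R‖ / n * K := by positivity
  have hRZ : ∀ t : I, ‖R (SkorokhodSpace.bridge Z t)‖ ≤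
      ‖R (centeredSum n e ⌊(n : ℝ) * t⌋₊)‖ + ‖R‖ / n * K := fun t => by
    rw [bridge_partialSumProcess, map_sub]
    refine (norm_sub_le _ _).trans ?_
    gcongr
    refine (R.le_opNorm _).trans ?_
    rw [div_mul_eq_mul_div, mul_div_assoc, norm_smul, Real.norm_eq_abs]
    gcongr
    rw [div_eq_inv_mul K]
    refine mul_le_mul ?_ (SkorokhodSpace.norm_le_supNorm Z 1) (norm_nonneg _) (by positivity)
    have h0 : 0 ≤ (n : ℝ) * t := mul_nonneg hn'.le t.2.1
    have h1 := Nat.floor_le h0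
    have h2 := Nat.lt_floor_add_one ((n : ℝ) * t)
    have h3 : (t : ℝ) - (⌊(n : ℝ) * t⌋₊ : ℝ) / n = ((n : ℝ) * t - ⌊(n : ℝ) * t⌋₊) * (n : ℝ)⁻¹ := by
      field_simp
    rw [h3, abs_of_nonneg (mul_nonneg (by linarith) (by positivity))]
    exact mul_le_of_le_one_left (by positivity) (by linarith)
  rw [abs_sub_le_iff, sub_le_iff_le_add, sub_le_iff_le_add]
  constructor
  · rw [hstat]
    refine Real.iSup_le (fun k => ?_) ?_
    · obtain ⟨t, ht⟩ := centeredSum_eq_bridge k.2 e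
      have h1 := SkorokhodSpace.norm_bridge_le_bridgeSup R Z t
      rw [← ht] at h1
      linarith [(abs_sub_le_iff.1 (hdiff k)).1]
    · have : 0 ≤ SkorokhodSpace.bridgeSup R Z := Real.iSup_nonneg fun _ => norm_nonneg _
      positivity
  · refine ciSup_le fun t => (hRZ t).trans ?_
    have hfl : ⌊(n : ℝ) * t⌋₊ ≤ n :=
      Nat.floor_le_of_le (mul_le_of_le_one_right hn'.le t.2.2)
    have hdK : 0 ≤ 2 * d * K := by positivity
    -- The maximum in the statistic omits `k = 0` and `k = n`, where the centered sum vanishes.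
    by_cases hk : ⌊(n : ℝ) * t⌋₊ ∈ Finset.Ico 1 n
    · have h1 := (abs_sub_le_iff.1 (hdiff ⟨_, hk⟩)).2
      have h2 : shiftNorm (centeredSum n e ⌊(n : ℝ) * t⌋₊) T ≤ weightedStatistic T n x := by
        rw [hstat]
        exact le_ciSup (f := fun k : Finset.Ico 1 n => shiftNorm (centeredSum n e k) T)
          (Set.finite_range _).bddAbove ⟨_, hk⟩
      linarith
    · have h0 : centeredSum n e ⌊(n : ℝ) * t⌋₊ = 0 := by
        rw [Finset.mem_Ico, not_and, not_lt] at hk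
        rcases Nat.eq_zero_or_pos ⌊(n : ℝ) * t⌋₊ with h | h
        · rw [h, centeredSum_zero]
        · rw [le_antisymm hfl (hk h), centeredSum_self hn]
      rw [h0, map_zero, norm_zero]
      linarith

/-! ### Measurability of the statistic -/

theorem aemeasurable_weightedStatistic [Nontrivial H] [TopologicalSpace.SeparableSpace H]
    [MeasurableSpace H] [BorelSpace H] {Ω : Type*} [MeasurableSpace Ω] {P : Measure Ω}
    {T : Ω → H →L[ℝ] H} (hT : AEStronglyMeasurable T P)
    (hTsa : ∀ᵐ ω ∂P, IsSelfAdjoint (T ω)) (hTc : ∀ᵐ ω ∂P, IsCompactOperator (T ω))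
    (n : ℕ) {X : ℕ → Ω → H} (hX : ∀ i, Measurable (X i)) :
    AEMeasurable (fun ω => weightedStatistic (T ω) n fun i => X i ω) P := by
  have : SecondCountableTopology H := UniformSpace.secondCountable_of_separable H
  have h : AEMeasurable (fun ω => ⨆ k : Finset.Ico 1 n,
      shiftNorm ((√(n : ℝ))⁻¹ • ∑ i ∈ Finset.Icc 1 (k : ℕ),
        (X i ω - sampleMean n fun i => X i ω)) (T ω)) P := by
    refine AEMeasurable.iSup fun k => ?_
    have hm : Measurable fun ω => (√(n : ℝ))⁻¹ • ∑ i ∈ Finset.Icc 1 (k : ℕ),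
        (X i ω - sampleMean n fun i => X i ω) := by
      unfold sampleMean
      fun_prop
    have := measurable_shiftNorm.comp_aemeasurable (hm.aemeasurable.prodMk hT.aemeasurable)
    exact this
  refine h.congr ?_
  filter_upwards [hTsa, hTc] with ω h1 h2
  rw [weightedStatistic_eq_iSup_shiftNorm h1 h2]

end Statistic

/-! ### Convergence in distribution of the statistic -/

section Convergence

variable {Ω : Type*} [MeasurableSpace Ω] {P : Measure Ω} [IsProbabilityMeasure P]
  {Ω' : Type*} [MeasurableSpace Ω'] {P' : Measure Ω'} [IsProbabilityMeasure P']

/-- Tightness from above: the limit law gives small mass to some `[k, ∞)`, and the portmanteau bound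
for this closed set carries that over to large `n`. -/
theorem exists_eventually_measure_ge_lt {M : ℕ → Ω → ℝ} {Z : Ω' → ℝ}
    (h : TendstoInDistribution M atTop Z (fun _ => P) P') {ε : ℝ≥0∞} (hε : 0 < ε) :
    ∃ K : ℝ, ∀ᶠ n in atTop, P {ω | K ≤ M n ω} < ε := by
  have : IsProbabilityMeasure (P'.map Z) := Measure.isProbabilityMeasure_map h.aemeasurable_limit
  have hinter : ⋂ k : ℕ, Ici (k : ℝ) = ∅ := by
    refine eq_empty_of_forall_notMem fun x hx => ?_
    obtain ⟨k, hk⟩ := exists_nat_gt x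
    exact absurd (mem_iInter.1 hx k) (not_le.2 hk)
  have h1 : Tendsto (fun k : ℕ => P'.map Z (Ici (k : ℝ))) atTop (𝓝 0) := by
    have := tendsto_measure_iInter_atTop (μ := P'.map Z) (s := fun k : ℕ => Ici (k : ℝ))
      (fun _ => measurableSet_Ici.nullMeasurableSet)
      (fun i j hij => Ici_subset_Ici.2 (by exact_mod_cast hij)) ⟨0, measure_ne_top _ _⟩
    rwa [hinter, measure_empty] at this
  obtain ⟨k, hk⟩ := (h1.eventually_lt_const hε).exists
  refine ⟨k, ?_⟩
  have h2 := ProbabilityMeasure.limsup_measure_closed_le_of_tendsto h.tendsto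
    (isClosed_Ici (a := (k : ℝ)))
  have h3 := eventually_lt_of_limsup_lt (h2.trans_lt hk)
  filter_upwards [h3] with n hn
  rw [ProbabilityMeasure.coe_mk, Measure.map_apply_of_aemeasurable (h.forall_aemeasurable n)
    measurableSet_Ici] at hn
  exact hn

variable {H : Type*} [NormedAddCommGroup H] [InnerProductSpace ℝ H] [CompleteSpace H]

theorem tendstoInDistribution_weightedStatistic [Nontrivial H]
    [TopologicalSpace.SeparableSpace H] [MeasurableSpace H] [BorelSpace H]
    {ε : ℤ → Ω → H} {W : Ω' → SkorokhodSpace H}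
    (hfclt : TendstoInDistribution
      (fun (n : ℕ) ω => partialSumProcess n (fun i => ε i ω)) atTop W (fun _ => P) P')
    {C : H →L[ℝ] H} (hC : IsSelfAdjoint C) (hCs : C ∈ coerciveShiftSet H)
    {T : ℕ → Ω → H →L[ℝ] H} (hTm : ∀ n, AEStronglyMeasurable (T n) P)
    (hTsa : ∀ n, ∀ᵐ ω ∂P, IsSelfAdjoint (T n ω))
    (hTc : ∀ n, ∀ᵐ ω ∂P, IsCompactOperator (T n ω))
    (hT : TendstoInMeasure P T atTop (fun _ => C))
    {m : H} {X : ℕ → Ω → H} (hXm : ∀ i, Measurable (X i))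
    (hX : ∀ i, 1 ≤ i → ∀ ω, X i ω = m + ε i ω)
    {R : H →L[ℝ] H} (hR : R = invSqrtOp (C + rayleighSup C • ContinuousLinearMap.id ℝ H)) :
    TendstoInDistribution (fun (n : ℕ) ω => weightedStatistic (T n ω) n fun i => X i ω) atTop
      (fun ω => SkorokhodSpace.bridgeSup R (W ω)) (fun _ => P) P' := by
  have hb : TendstoInDistribution
      (fun (n : ℕ) ω => SkorokhodSpace.bridgeSup R (partialSumProcess n fun i => ε i ω)) atTop
      (fun ω => SkorokhodSpace.bridgeSup R (W ω)) (fun _ => P) P' := by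
    have h := hfclt.continuous_comp (SkorokhodSpace.continuous_bridgeSup R)
    exact h
  have hs : TendstoInDistribution
      (fun (n : ℕ) ω => SkorokhodSpace.supNorm (partialSumProcess n fun i => ε i ω)) atTop
      (fun ω => SkorokhodSpace.supNorm (W ω)) (fun _ => P) P' := by
    have h := hfclt.continuous_comp SkorokhodSpace.continuous_supNorm
    exact h
  refine tendstoInDistribution_of_tendstoInMeasure_sub _ _ hb ?_
    fun n => aemeasurable_weightedStatistic (hTm n) (hTsa n) (hTc n) n hXm
  rw [tendstoInMeasure_iff_norm]
  intro r hr
  rw [ENNReal.tendsto_nhds_zero]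
  intro η hη
  have hη2 : 0 < η / 2 := ENNReal.half_pos hη.ne'
  obtain ⟨K, hK⟩ := exists_eventually_measure_ge_lt hs hη2
  -- Off two events of probability below `η / 2`, the estimator is close to `C` and the path is
  -- bounded by `K`. The error bound then splits into an operator part and a discretization part,
  -- each below `r / 2`.
  have hcont : ∀ᶠ S in 𝓝 C, S ∈ coerciveShiftSet H ∧
      2 * √‖invShift S - invShift C‖ * |K| < r / 2 := by
    have hnhds := isOpen_coerciveShiftSet.mem_nhds hCs
    refine Filter.Eventually.and hnhds ?_
    have h1 : ContinuousAt (fun S : H →L[ℝ] H => 2 * √‖invShift S - invShift C‖ * |K|) C := by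
      have := continuousOn_invShift.continuousAt hnhds
      fun_prop
    refine h1.eventually_lt_const ?_
    simpa using hr
  obtain ⟨δ, hδ, hball⟩ := Metric.eventually_nhds_iff.1 hcont
  have hN : ∀ᶠ n : ℕ in atTop, ‖R‖ / n * |K| < r / 2 := by
    have h1 : Tendsto (fun n : ℕ => ‖R‖ / n * |K|) atTop (𝓝 (0 * |K|)) :=
      (tendsto_const_div_atTop_nhds_zero_nat _).mul_const _
    rw [zero_mul] at h1
    exact h1.eventually_lt_const (by positivity)
  have hTd := (tendstoInMeasure_iff_norm.1 hT δ hδ).eventually_lt_const hη2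
  filter_upwards [hK, hN, hTd, eventually_gt_atTop 0] with n hKn hNn hTn hn
  have hsub : {ω | r ≤ ‖((fun (n : ℕ) ω => weightedStatistic (T n ω) n fun i => X i ω) -
        fun (n : ℕ) ω => SkorokhodSpace.bridgeSup R (partialSumProcess n fun i => ε i ω)) n ω -
        (0 : Ω → ℝ) ω‖} ≤ᵐ[P]
      ({ω | K ≤ SkorokhodSpace.supNorm (partialSumProcess n fun i => ε i ω)} ∪
        {ω | δ ≤ ‖T n ω - C‖} : Set Ω) := by
    filter_upwards [hTsa n, hTc n] with ω h1 h2 hω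
    by_contra hnot
    obtain ⟨hnot1, hnot2⟩ := not_or.1 hnot
    have hω' : r ≤ |weightedStatistic (T n ω) n (fun i => X i ω) -
      SkorokhodSpace.bridgeSup R (partialSumProcess n fun i => ε i ω)| := by
      simpa using! hω
    have h3 : SkorokhodSpace.supNorm (partialSumProcess n fun i => ε i ω) < K := not_le.1 hnot1
    have h4 : ‖T n ω - C‖ < δ := not_le.1 hnot2
    obtain ⟨h5, h6⟩ := hball (by rwa [dist_eq_norm])
    have h7 := abs_weightedStatistic_sub_bridgeSup_le h1 h2 h5 hC hCs hn
      (e := fun i => ε i ω) (fun i hi => hX i hi ω) hR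
    have h8 : (2 * √‖invShift (T n ω) - invShift C‖ + ‖R‖ / n) *
        SkorokhodSpace.supNorm (partialSumProcess n fun i => ε i ω) ≤
        (2 * √‖invShift (T n ω) - invShift C‖ + ‖R‖ / n) * |K| := by
      gcongr
      exact h3.le.trans (le_abs_self K)
    linarith
  calc _ ≤ _ := measure_mono_ae hsub
    _ ≤ _ := measure_union_le _ _
    _ ≤ η / 2 + η / 2 := add_le_add hKn.le hTn.le
    _ = η := ENNReal.add_halves η

end Convergence

/-! ### Gaussian laws determined by means and covariances -/

section Gaussian

variable {Ω : Type*} [MeasurableSpace Ω] {P : Measure Ω} {Ω' : Type*} [MeasurableSpace Ω']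
  {Q : Measure Ω'}

theorem covariance_congr_ae {X X' Y Y' : Ω → ℝ} (hX : X =ᵐ[P] X') (hY : Y =ᵐ[P] Y') :
    cov[X, Y; P] = cov[X', Y'; P] := by
  rw [covariance, covariance, integral_congr_ae hX, integral_congr_ae hY]
  refine integral_congr_ae ?_
  filter_upwards [hX, hY] with ω h1 h2
  rw [h1, h2]

/-- The characteristic function at a linear form depends only on the mean and variance of that form,
which are computed from the coordinates. -/
theorem HasGaussianLaw.map_eq_of_covariance_eq {ι : Type*} [Fintype ι] {X : Ω → ι → ℝ}
    {Y : Ω' → ι → ℝ} (hX : HasGaussianLaw X P) (hY : HasGaussianLaw Y Q)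
    (hmean : ∀ i, ∫ ω, X ω i ∂P = ∫ ω, Y ω i ∂Q)
    (hcov : ∀ i j, cov[fun ω => X ω i, fun ω => X ω j; P] =
      cov[fun ω => Y ω i, fun ω => Y ω j; Q]) : P.map X = Q.map Y := by
  classical
  have := hX.isProbabilityMeasure
  have := hY.isProbabilityMeasure
  have := hX.isGaussian_map
  have := hY.isGaussian_map
  have hXi : ∀ i, HasGaussianLaw (fun ω => X ω i) P := fun i =>
    hX.map_fun (ContinuousLinearMap.proj (R := ℝ) (φ := fun _ : ι => ℝ) i)
  have hYi : ∀ i, HasGaussianLaw (fun ω => Y ω i) Q := fun i =>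
    hY.map_fun (ContinuousLinearMap.proj (R := ℝ) (φ := fun _ : ι => ℝ) i)
  refine Measure.ext_of_charFunDual (funext fun L => ?_)
  have hL : ∀ x : ι → ℝ, L x = ∑ i, L (Pi.single i 1) * x i := fun x => by
    conv_lhs => rw [pi_eq_sum_univ' x]
    simp [mul_comm]
  rw [hX.charFunDual_map_eq_fun, hY.charFunDual_map_eq_fun]
  rw [show (L : (ι → ℝ) → ℝ) = fun x => ∑ i, L (Pi.single i 1) * x i from funext hL]
  have hmean' : ∫ ω, ∑ i, L (Pi.single i 1) * X ω i ∂P =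
      ∫ ω, ∑ i, L (Pi.single i 1) * Y ω i ∂Q := by
    rw [integral_finsetSum _ fun i _ => (hXi i).integrable.const_mul _,
      integral_finsetSum _ fun i _ => (hYi i).integrable.const_mul _]
    simp only [integral_const_mul, hmean]
  have hvar : Var[fun ω => ∑ i, L (Pi.single i 1) * X ω i; P] =
      Var[fun ω => ∑ i, L (Pi.single i 1) * Y ω i; Q] := by
    rw [variance_fun_sum fun i => (hXi i).memLp_two.const_mul _,
      variance_fun_sum fun i => (hYi i).memLp_two.const_mul _]
    simp only [covariance_const_mul_left, covariance_const_mul_right, hcov]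
  simp only [hmean', hvar]

theorem IsGaussianProcess.map_eq_of_covariance_eq {T : Type*} [Countable T] {X : T → Ω → ℝ}
    {Y : T → Ω' → ℝ} (hX : IsGaussianProcess X P) (hY : IsGaussianProcess Y Q)
    (hmean : ∀ t, ∫ ω, X t ω ∂P = ∫ ω, Y t ω ∂Q)
    (hcov : ∀ s t, cov[X s, X t; P] = cov[Y s, Y t; Q]) :
    P.map (fun ω t => X t ω) = Q.map (fun ω t => Y t ω) := by
  have := hX.isProbabilityMeasure
  have := hY.isProbabilityMeasure
  have h1 := isProjectiveLimit_map (P := P) (X := X) (aemeasurable_pi_lambda _ hX.aemeasurable)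
  have h2 := isProjectiveLimit_map (P := Q) (X := Y) (aemeasurable_pi_lambda _ hY.aemeasurable)
  have h3 : (fun J : Finset T => P.map fun ω => J.restrict fun t => X t ω) =
      fun J : Finset T => Q.map fun ω => J.restrict fun t => Y t ω := by
    funext J
    exact HasGaussianLaw.map_eq_of_covariance_eq (hX.hasGaussianLaw J) (hY.hasGaussianLaw J)
      (fun i => hmean i) fun i j => hcov i j
  rw [h3] at h1
  have (J : Finset T) : IsProbabilityMeasure (Q.map fun ω => J.restrict fun t => Y t ω) :=
    (hY.hasGaussianLaw J).isGaussian_map.toIsProbabilityMeasure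
  exact h1.unique h2

/-- A finite set of index pairs lies in a finite rectangle. On it, independence makes the rows
jointly Gaussian, and the selected coordinates are a linear image. -/
theorem iIndepFun.isGaussianProcess {S T : Type*} {X : S → T → Ω → ℝ}
    (hX : ∀ s, IsGaussianProcess (X s) P) (hind : iIndepFun (fun s ω t => X s t ω) P) :
    IsGaussianProcess (fun (q : S × T) ω => X q.1 q.2 ω) P where
  hasGaussianLaw J := by
    classical
    have h1 : iIndepFun (fun (s : J.image Prod.fst) ω (t : J.image Prod.snd) => X s t ω) P :=
      (hind.precomp (g := ((↑) : J.image Prod.fst → S)) Subtype.val_injective).comp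
        (fun _ x => (J.image Prod.snd).restrict x) fun _ => Finset.measurable_restrict _
    have h2 := iIndepFun.hasGaussianLaw
      (fun s : J.image Prod.fst => (hX s).hasGaussianLaw (J.image Prod.snd)) h1
    let L : (J.image Prod.fst → J.image Prod.snd → ℝ) →L[ℝ] J → ℝ :=
      { toFun x q := x ⟨q.1.1, Finset.mem_image_of_mem _ q.2⟩ ⟨q.1.2, Finset.mem_image_of_mem _ q.2⟩
        map_add' x y := by ext; simp
        map_smul' c x := by ext; simp }
    exact h2.map L

theorem covariance_of_iIndepFun {S T : Type*} [DecidableEq S] {X : S → T → Ω → ℝ}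
    (hX : ∀ s, IsGaussianProcess (X s) P) (hind : iIndepFun (fun s ω t => X s t ω) P)
    {s s' : S} (hs : s ≠ s') (t t' : T) : cov[X s t, X s' t'; P] = 0 := by
  have := hind.isProbabilityMeasure
  have h := (hind.indepFun hs).comp (measurable_pi_apply t) (measurable_pi_apply t')
  exact h.covariance_eq_zero ((hX s).hasGaussianLaw_eval t).memLp_two
    ((hX s').hasGaussianLaw_eval t').memLp_two

end Gaussian

/-! ### The bridge of a Hilbert space valued Brownian motion -/

namespace IsHilbertBrownianMotion

variable {H : Type*} [NormedAddCommGroup H] [InnerProductSpace ℝ H] [MeasurableSpace H]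
  {Ω : Type*} [MeasurableSpace Ω] {P : Measure Ω} {C : H →L[ℝ] H} {W : I → Ω → H}

theorem sub_zero_ae_eq (hW : IsHilbertBrownianMotion C W P) (t : I) :
    (fun ω => W t ω - W 0 ω) =ᵐ[P] W t := by
  filter_upwards [hW.zero] with ω h
  rw [h, sub_zero]

variable [CompleteSpace H] [SecondCountableTopology H] [BorelSpace H]

theorem isGaussianProcess (hW : IsHilbertBrownianMotion C W P) : IsGaussianProcess W P :=
  hW.indep_increments.isGaussianProcess
    (fun t => (hW.gaussian 0 t t.2.1).congr (hW.sub_zero_ae_eq t)) hW.zero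

theorem hasGaussianLaw_inner (hW : IsHilbertBrownianMotion C W P) (x : H) (t : I) :
    HasGaussianLaw (fun ω => ⟪x, W t ω⟫) P :=
  (hW.isGaussianProcess.hasGaussianLaw_eval t).map_fun (innerSL ℝ x)

theorem integral_inner_eq_zero (hW : IsHilbertBrownianMotion C W P) (x : H) (t : I) :
    ∫ ω, ⟪x, W t ω⟫ ∂P = 0 := by
  rw [integral_inner (hW.isGaussianProcess.hasGaussianLaw_eval t).integrable,
    ← integral_congr_ae (hW.sub_zero_ae_eq t), hW.centered 0 t t.2.1, inner_zero_right]

theorem covariance_inner_of_le (hW : IsHilbertBrownianMotion C W P) {s t : I} (hst : s ≤ t)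
    (x y : H) : cov[fun ω => ⟪x, W s ω⟫, fun ω => ⟪y, W t ω⟫; P] = (s : ℝ) * ⟪C x, y⟫ := by
  have := hW.isGaussianProcess.isProbabilityMeasure
  have h1 : cov[fun ω => ⟪x, W s ω⟫, fun ω => ⟪y, W s ω⟫; P] = (s : ℝ) * ⟪C x, y⟫ := by
    have h := hW.covariance 0 s s.2.1 x y
    rw [show ((0 : I) : ℝ) = 0 from rfl, sub_zero] at h
    rw [← h]
    refine covariance_congr_ae ?_ ?_
    · filter_upwards [hW.sub_zero_ae_eq s] with ω hω using by rw [hω]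
    · filter_upwards [hW.sub_zero_ae_eq s] with ω hω using by rw [hω]
  have hmem : MemLp (fun ω => ⟪y, W t ω - W s ω⟫) 2 P :=
    ((hW.gaussian s t hst).map_fun (innerSL ℝ y)).memLp_two
  have h2 : cov[fun ω => ⟪x, W s ω⟫, fun ω => ⟪y, W t ω - W s ω⟫; P] = 0 := by
    have h := (hW.indep_increments.indepFun_eval_sub s.2.1 hst hW.zero).comp
      (innerSL ℝ x).measurable (innerSL ℝ y).measurable
    exact h.covariance_eq_zero (hW.hasGaussianLaw_inner x s).memLp_two hmem
  have h3 : (fun ω => ⟪y, W t ω⟫) = (fun ω => ⟪y, W s ω⟫) + fun ω => ⟪y, W t ω - W s ω⟫ := by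
    funext ω
    rw [Pi.add_apply, ← inner_add_right, add_sub_cancel]
  rw [h3, covariance_add_right (hW.hasGaussianLaw_inner x s).memLp_two
    (hW.hasGaussianLaw_inner y s).memLp_two hmem, h1, h2, add_zero]

theorem covariance_inner (hW : IsHilbertBrownianMotion C W P) (hC : IsSelfAdjoint C) (s t : I)
    (x y : H) :
    cov[fun ω => ⟪x, W s ω⟫, fun ω => ⟪y, W t ω⟫; P] = min (s : ℝ) t * ⟪C x, y⟫ := by
  rcases le_total s t with h | h
  · rw [hW.covariance_inner_of_le h, min_eq_left (show (s : ℝ) ≤ t from h)]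
  · rw [covariance_comm, hW.covariance_inner_of_le h, min_eq_right (show (t : ℝ) ≤ s from h),
      hC.inner_apply_comm, real_inner_comm]

theorem integral_inner_bridge (hW : IsHilbertBrownianMotion C W P) (x : H) (t : I) :
    ∫ ω, ⟪x, W t ω - (t : ℝ) • W 1 ω⟫ ∂P = 0 := by
  simp only [inner_sub_right, real_inner_smul_right]
  rw [integral_sub (hW.hasGaussianLaw_inner x t).integrable
    ((hW.hasGaussianLaw_inner x 1).integrable.const_mul _), integral_const_mul,
    hW.integral_inner_eq_zero, hW.integral_inner_eq_zero, mul_zero, sub_zero]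

theorem covariance_inner_bridge (hW : IsHilbertBrownianMotion C W P) (hC : IsSelfAdjoint C)
    (s t : I) (x y : H) :
    cov[fun ω => ⟪x, W s ω - (s : ℝ) • W 1 ω⟫, fun ω => ⟪y, W t ω - (t : ℝ) • W 1 ω⟫; P] =
      (min (s : ℝ) t - s * t) * ⟪C x, y⟫ := by
  have := hW.isGaussianProcess.isProbabilityMeasure
  have hm : ∀ (z : H) (u : I), MemLp (fun ω => ⟪z, W u ω⟫) 2 P := fun z u =>
    (hW.hasGaussianLaw_inner z u).memLp_two
  simp only [inner_sub_right, real_inner_smul_right]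
  rw [covariance_fun_sub_fun_sub (hm x s) ((hm x 1).const_mul _) (hm y t)
    ((hm y 1).const_mul _)]
  simp only [covariance_const_mul_left, covariance_const_mul_right, hW.covariance_inner hC]
  have h1 : min (s : ℝ) ((1 : I) : ℝ) = s := min_eq_left s.2.2
  have h2 : min ((1 : I) : ℝ) (t : ℝ) = t := min_eq_right t.2.2
  have h3 : min ((1 : I) : ℝ) ((1 : I) : ℝ) = 1 := min_self _
  rw [h1, h2, h3]
  ring

theorem isGaussianProcess_inner_bridge (hW : IsHilbertBrownianMotion C W P) {ι : Type*}
    (e : ι → H) :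
    IsGaussianProcess (fun (q : ι × I) ω => ⟪e q.1, W q.2 ω - (q.2 : ℝ) • W 1 ω⟫) P := by
  classical
  refine hW.isGaussianProcess.of_isGaussianProcess fun q => ⟨{q.2, 1},
    (innerSL ℝ (e q.1)) ∘L (ContinuousLinearMap.proj (R := ℝ) ⟨q.2, by simp⟩ -
      (q.2 : ℝ) • ContinuousLinearMap.proj (R := ℝ) ⟨1, by simp⟩), fun ω => ?_⟩
  simp [inner_sub_right, real_inner_smul_right]

end IsHilbertBrownianMotion

/-! ### Consequences of the spectral decomposition -/

namespace IsSpectralDecomposition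

variable {H : Type*} [NormedAddCommGroup H] [InnerProductSpace ℝ H] {C : H →L[ℝ] H} {lam : ℕ → ℝ}
  {v : ℕ → H}

theorem norm_eq_one (h : IsSpectralDecomposition C lam v) {p : ℕ} (hp : lam p ≠ 0) : ‖v p‖ = 1 :=
  h.orthonormal.1 ⟨p, hp⟩

theorem inner_eq_zero (h : IsSpectralDecomposition C lam v) {p q : ℕ} (hp : lam p ≠ 0)
    (hq : lam q ≠ 0) (hpq : p ≠ q) : ⟪v p, v q⟫ = 0 :=
  h.orthonormal.2 (i := ⟨p, hp⟩) (j := ⟨q, hq⟩) fun h => hpq (congrArg Subtype.val h)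

theorem tendsto_zero (h : IsSpectralDecomposition C lam v) : Tendsto lam atTop (𝓝 0) := by
  have h1 := h.hasSum.summable.tendsto_atTop_zero
  rw [tendsto_zero_iff_norm_tendsto_zero] at h1 ⊢
  refine h1.congr fun p => ?_
  rcases eq_or_ne (lam p) 0 with hp | hp
  · simp [hp]
  · simp [norm_smul, h.norm_eq_one hp]

theorem nonneg (h : IsSpectralDecomposition C lam v) (p : ℕ) : 0 ≤ lam p :=
  h.antitone.le_of_tendsto h.tendsto_zero p

theorem pos (h : IsSpectralDecomposition C lam v) {p : ℕ} (hp : lam p ≠ 0) : 0 < lam p :=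
  (h.nonneg p).lt_of_ne' hp

theorem zero_pos (h : IsSpectralDecomposition C lam v) (hC : C ≠ 0) : 0 < lam 0 := by
  refine (h.nonneg 0).lt_of_ne' fun h0 => hC ?_
  have h1 : ∀ p, lam p = 0 := fun p =>
    le_antisymm (h0 ▸ h.antitone (Nat.zero_le p)) (h.nonneg p)
  have h2 := h.hasSum
  simp only [h1, zero_smul] at h2
  exact h2.unique hasSum_zero

theorem hasSum_apply (h : IsSpectralDecomposition C lam v) (x : H) :
    HasSum (fun p => lam p • ⟪v p, x⟫ • v p) (C x) := by
  simpa using (ContinuousLinearMap.apply ℝ H x).hasSum h.hasSum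

theorem hasSum_inner (h : IsSpectralDecomposition C lam v) (x y : H) :
    HasSum (fun p : {p // lam p ≠ 0} => lam p * (⟪v p, x⟫ * ⟪v p, y⟫)) ⟪C x, y⟫ := by
  have h1 := (innerSL ℝ y).hasSum (h.hasSum_apply x)
  simp only [innerSL_apply_apply, real_inner_comm _ y, real_inner_smul_left] at h1
  exact (hasSum_subtype_iff_of_support_subset (s := {p | lam p ≠ 0})
    (f := fun p => lam p * (⟪v p, x⟫ * ⟪v p, y⟫)) fun p hp h0 => hp (by simp [h0])).2 h1

theorem isSelfAdjoint [CompleteSpace H] (h : IsSpectralDecomposition C lam v) :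
    IsSelfAdjoint C := by
  rw [ContinuousLinearMap.isSelfAdjoint_iff_isSymmetric]
  intro x y
  change ⟪C x, y⟫ = ⟪x, C y⟫
  refine (h.hasSum_inner x y).unique ?_
  rw [real_inner_comm]
  simpa only [mul_comm ⟪v _, y⟫] using h.hasSum_inner y x

theorem apply_eq_smul (h : IsSpectralDecomposition C lam v) {p : ℕ} (hp : lam p ≠ 0) :
    C (v p) = lam p • v p := by
  refine (h.hasSum_apply (v p)).unique ?_
  have h1 := hasSum_single (f := fun q => lam q • ⟪v q, v p⟫ • v q) p fun q hq => by
    rcases eq_or_ne (lam q) 0 with h0 | h0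
    · simp [h0]
    · simp [h.inner_eq_zero h0 hp hq]
  simpa [real_inner_self_eq_norm_sq, h.norm_eq_one hp] using h1

theorem apply_eq_zero (h : IsSpectralDecomposition C lam v) {x : H}
    (hx : ∀ p, lam p ≠ 0 → ⟪v p, x⟫ = 0) : C x = 0 := by
  refine (h.hasSum_apply x).unique ?_
  convert! hasSum_zero (α := H) (β := ℕ) using 1
  funext p
  rcases eq_or_ne (lam p) 0 with h0 | h0
  · simp [h0]
  · simp [hx p h0]

theorem inner_apply_self_nonneg (h : IsSpectralDecomposition C lam v) (x : H) : 0 ≤ ⟪C x, x⟫ :=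
  (h.hasSum_inner x x).nonneg fun p : {p // lam p ≠ 0} =>
    mul_nonneg (h.nonneg p) (mul_self_nonneg _)

theorem inner_apply_self_le (h : IsSpectralDecomposition C lam v) (x : H) :
    ⟪C x, x⟫ ≤ lam 0 * ‖x‖ ^ 2 := by
  have h1 := h.orthonormal.inner_products_summable x
  have h2 := h.orthonormal.tsum_inner_products_le x
  refine (hasSum_le (fun p => ?_) (h.hasSum_inner x x) (h1.hasSum.mul_left (lam 0))).trans ?_
  · rw [Real.norm_eq_abs, sq_abs, ← pow_two]
    exact mul_le_mul_of_nonneg_right (h.antitone (Nat.zero_le _)) (sq_nonneg _)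
  · exact mul_le_mul_of_nonneg_left h2 (h.nonneg 0)

theorem rayleighSup_eq [Nontrivial H] (h : IsSpectralDecomposition C lam v) (hC : C ≠ 0) :
    rayleighSup C = lam 0 := by
  have h0 := (h.zero_pos hC).ne'
  refine le_antisymm (rayleighSup_le fun x hx => ?_) ?_
  · simpa [hx] using h.inner_apply_self_le x
  · have h1 := inner_le_rayleighSup C (v 0)
    simpa [h.apply_eq_smul h0, real_inner_smul_left, real_inner_self_eq_norm_sq,
      h.norm_eq_one h0] using h1

theorem mem_coerciveShiftSet [Nontrivial H] (h : IsSpectralDecomposition C lam v) (hC : C ≠ 0) :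
    C ∈ coerciveShiftSet H := by
  have h0 := h.zero_pos hC
  have h1 : rayleighSup (-C) ≤ 0 := rayleighSup_le fun x _ => by
    simpa using h.inner_apply_self_nonneg x
  rw [coerciveShiftSet, mem_ofPred_eq, h.rayleighSup_eq hC]
  exact ⟨h0, h1.trans_lt h0⟩

variable [CompleteSpace H]

theorem invShift_apply [Nontrivial H] (h : IsSpectralDecomposition C lam v) (hC : C ≠ 0) {p : ℕ}
    (hp : lam p ≠ 0) : invShift C (v p) = (lam p + lam 0)⁻¹ • v p := by
  have hu := isUnit_of_coercive (sub_pos.2 (h.mem_coerciveShiftSet hC).2)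
    (coercive_of_mem_coerciveShiftSet C)
  have h1 := Ring.inverse_mul_cancel _ hu
  have h2 : (C + rayleighSup C • ContinuousLinearMap.id ℝ H) (v p) = (lam p + lam 0) • v p := by
    simp [h.apply_eq_smul hp, h.rayleighSup_eq hC, add_smul]
  have h3 : invShift C ((C + rayleighSup C • ContinuousLinearMap.id ℝ H) (v p)) = v p :=
    congrArg (fun S : H →L[ℝ] H => S (v p)) h1
  have h4 : lam p + lam 0 ≠ 0 := (add_pos (h.pos hp) (h.zero_pos hC)).ne'
  rw [h2, map_smul] at h3
  rw [eq_inv_smul_iff₀ h4, h3]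

/-- Let `s` be the sum of the eigenvector expansion of `x`. Then `x - s` is orthogonal to every `v
p` with `lam p ≠ 0`, so it lies in the kernel of `C` and is orthogonal to both `x` and `s`, hence to
itself. -/
theorem hasSum_of_orthogonal_ker (h : IsSpectralDecomposition C lam v) {x : H}
    (hx : ∀ z, C z = 0 → ⟪z, x⟫ = 0) : HasSum (fun p : {p // lam p ≠ 0} => ⟪v p, x⟫ • v p) x := by
  have hsum : Summable fun p : {p // lam p ≠ 0} => ⟪v p, x⟫ • v p := by
    have h1 := (h.orthonormal.orthogonalFamily.summable_iff_norm_sq_summable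
      (fun p : {p // lam p ≠ 0} => ⟪v p, x⟫)).2 (h.orthonormal.inner_products_summable x)
    simpa using h1
  have hs := hsum.hasSum
  set s := ∑' p : {p // lam p ≠ 0}, ⟪v p, x⟫ • v p with hsdef
  have hvs : ∀ q, lam q ≠ 0 → ⟪v q, s⟫ = ⟪v q, x⟫ := fun q hq => by
    refine ((innerSL ℝ (v q)).hasSum hs).unique ?_
    have h1 := hasSum_single (f := fun p : {p // lam p ≠ 0} => ⟪v q, ⟪v p, x⟫ • v p⟫) ⟨q, hq⟩
      fun p hp => by
        rw [real_inner_smul_right, h.inner_eq_zero hq p.2 fun h => hp (Subtype.ext h.symm),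
          mul_zero]
    simpa [real_inner_smul_right, real_inner_self_eq_norm_sq, h.norm_eq_one hq] using h1
  have hker : C (x - s) = 0 := h.apply_eq_zero fun p hp => by
    rw [inner_sub_right, hvs p hp, sub_self]
  have hzs : ⟪x - s, s⟫ = 0 := by
    refine ((innerSL ℝ (x - s)).hasSum hs).unique ?_
    convert! hasSum_zero (α := ℝ) (β := {p // lam p ≠ 0}) using 1
    funext p
    simp only [innerSL_apply_apply]
    rw [real_inner_smul_right, real_inner_comm (v p) (x - s), inner_sub_right, hvs p p.2, sub_self, mul_zero]
  have h0 : ⟪x - s, x - s⟫ = 0 := by rw [inner_sub_right, hx _ hker, hzs, sub_zero]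
  rw [inner_self_eq_zero, sub_eq_zero] at h0
  rwa [h0.symm] at hs

theorem hasSum_norm_sq [Nontrivial H] (h : IsSpectralDecomposition C lam v) (hC : C ≠ 0) {x : H}
    (hx : ∀ z, C z = 0 → ⟪z, x⟫ = 0) :
    HasSum (fun p : {p // lam p ≠ 0} => (lam p + lam 0)⁻¹ * ⟪v p, x⟫ ^ 2)
      (‖invSqrtOp (C + rayleighSup C • ContinuousLinearMap.id ℝ H) x‖ ^ 2) := by
  rw [norm_sq_invSqrtOp_apply (isSelfAdjoint_shift h.isSelfAdjoint _)
    (sub_pos.2 (h.mem_coerciveShiftSet hC).2) (coercive_of_mem_coerciveShiftSet C)]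
  have h1 := (innerSL ℝ x).hasSum ((invShift C).hasSum (h.hasSum_of_orthogonal_ker hx))
  rw [real_inner_comm]
  convert! h1 using 1
  funext p
  simp only [map_smul, h.invShift_apply hC p.2, innerSL_apply_apply,
    smul_eq_mul, real_inner_comm (v p) x]
  ring

end IsSpectralDecomposition

/-! ### Suprema of series over a dense set of times -/

section LimitLaw

theorem iSup_denseSeq_eq_iSup {f : I → ℝ≥0∞} (hf : LowerSemicontinuous f) :
    ⨆ n, f (TopologicalSpace.denseSeq I n) = ⨆ t, f t := by
  refine le_antisymm (iSup_le fun n => le_iSup f _) (iSup_le fun t => ?_)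
  refine le_of_forall_lt fun c hc => ?_
  obtain ⟨_, h1, n, rfl⟩ := (TopologicalSpace.denseRange_denseSeq I).inter_open_nonempty _
    (hf.isOpen_preimage c) ⟨t, hc⟩
  exact lt_of_lt_of_le h1 (le_iSup (fun n => f (TopologicalSpace.denseSeq I n)) n)

/-- The supremum over `n` of the series `∑ₚ aₚ x(p, n)²`. -/
def seriesSup {ι : Type*} (a : ι → ℝ) (x : ι × ℕ → ℝ) : ℝ≥0∞ :=
  ⨆ n, ∑' p, ENNReal.ofReal (a p * x (p, n) ^ 2)

theorem measurable_seriesSup {ι : Type*} [Countable ι] (a : ι → ℝ) : Measurable (seriesSup a) := by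
  refine Measurable.iSup fun n => Measurable.tsum fun p => ?_
  fun_prop

/-- Normalizing a coordinate by `√(lam p)` requires `lam p ≠ 0`. The discarded indices carry zero
weight in the limit series. -/
theorem seriesSup_subtype {a : ℕ → ℝ} {s : Set ℕ} (hs : ∀ p ∉ s, a p = 0) (x : ℕ × ℕ → ℝ) :
    seriesSup (fun p : s => a p) (fun q => x (q.1, q.2)) = seriesSup a x := by
  unfold seriesSup
  refine iSup_congr fun n => ?_
  refine tsum_subtype_eq_of_support_subset
    (f := fun p => ENNReal.ofReal (a p * x (p, n) ^ 2)) fun p hp => ?_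
  by_contra h
  exact hp (by simp [hs p h])

/-- A sum of nonnegative continuous functions is lower semicontinuous in `ℝ≥0∞`, which is enough for
a dense sequence of times to capture its supremum. Neither continuity of the sum nor uniform
convergence is needed. A finite supremum then gives summability at every time. -/
theorem toReal_seriesSup_of_continuous {a : ℕ → ℝ} (ha : ∀ p, 0 ≤ a p) {b : ℕ → I → ℝ}
    (hb : ∀ p, Continuous (b p))
    (hfin : seriesSup a (fun q => b q.1 (TopologicalSpace.denseSeq I q.2)) ≠ ∞) :
    (∀ t, Summable fun p => a p * b p t ^ 2) ∧
      BddAbove (range fun t : I => ∑' p, a p * b p t ^ 2) ∧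
      ⨆ t : I, ∑' p, a p * b p t ^ 2 =
        (seriesSup a fun q => b q.1 (TopologicalSpace.denseSeq I q.2)).toReal := by
  set G : I → ℝ≥0∞ := fun t => ∑' p, ENNReal.ofReal (a p * b p t ^ 2) with hG
  have hlsc : LowerSemicontinuous G := lowerSemicontinuous_tsum fun p =>
    (ENNReal.continuous_ofReal.comp
      (continuous_const.mul ((hb p).pow 2))).lowerSemicontinuous
  have hsup : seriesSup a (fun q => b q.1 (TopologicalSpace.denseSeq I q.2)) = ⨆ t, G t :=
    iSup_denseSeq_eq_iSup hlsc
  rw [hsup] at hfin ⊢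
  have hGt : ∀ t, G t ≠ ∞ := fun t => ne_top_of_le_ne_top hfin (le_iSup G t)
  have hnn : ∀ t p, 0 ≤ a p * b p t ^ 2 := fun t p => mul_nonneg (ha p) (sq_nonneg _)
  have hreal : ∀ t, ∑' p, a p * b p t ^ 2 = (G t).toReal := fun t => by
    rw [hG, ENNReal.tsum_toReal_eq fun _ => ENNReal.ofReal_ne_top]
    exact tsum_congr fun p => (ENNReal.toReal_ofReal (hnn t p)).symm
  refine ⟨fun t => ?_, ⟨(⨆ t, G t).toReal, ?_⟩, ?_⟩
  · exact (ENNReal.summable_toReal (hGt t)).congr fun p => ENNReal.toReal_ofReal (hnn t p)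
  · rintro _ ⟨t, rfl⟩
    simp only [hreal]
    exact ENNReal.toReal_mono hfin (le_iSup G t)
  · simp only [hreal]
    exact (ENNReal.toReal_iSup hGt).symm

theorem SkorokhodSpace.iSup_denseSeq_ofReal_norm_sq {H : Type*} [NormedAddCommGroup H]
    [NormedSpace ℝ H] (R : H →L[ℝ] H) {x : SkorokhodSpace H} (hx : Continuous x) :
    ⨆ n, ENNReal.ofReal (‖R (bridge x (TopologicalSpace.denseSeq I n))‖ ^ 2) =
      ENNReal.ofReal (bridgeSup R x ^ 2) := by
  have hc : Continuous fun t => ‖R (bridge x t)‖ := by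
    unfold bridge
    fun_prop
  rw [iSup_denseSeq_eq_iSup (f := fun t => ENNReal.ofReal (‖R (bridge x t)‖ ^ 2))
    (show Continuous fun t => ENNReal.ofReal (‖R (bridge x t)‖ ^ 2) from
      ENNReal.continuous_ofReal.comp (hc.pow 2)).lowerSemicontinuous]
  refine le_antisymm (iSup_le fun t => ?_) ?_
  · gcongr
    exact norm_bridge_le_bridgeSup R x t
  · obtain ⟨t, -, ht⟩ := isCompact_univ.exists_isMaxOn univ_nonempty hc.continuousOn
    have h1 : bridgeSup R x = ‖R (bridge x t)‖ :=
      le_antisymm (ciSup_le fun s => ht (mem_univ s)) (norm_bridge_le_bridgeSup R x t)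
    rw [h1]
    exact le_iSup (fun t => ENNReal.ofReal (‖R (bridge x t)‖ ^ 2)) t

theorem TendstoInDistribution.of_map_eq {ι E Ω Ω' Ω'' : Type*} [MeasurableSpace Ω]
    {μ : Measure Ω} [IsProbabilityMeasure μ] [MeasurableSpace Ω'] {μ' : Measure Ω'}
    [IsProbabilityMeasure μ'] [MeasurableSpace Ω''] {μ'' : Measure Ω''} [IsProbabilityMeasure μ'']
    [TopologicalSpace E] [MeasurableSpace E] [OpensMeasurableSpace E] {X : ι → Ω → E}
    {l : Filter ι} {Z : Ω' → E} {Z' : Ω'' → E}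
    (h : TendstoInDistribution X l Z (fun _ => μ) μ') (hZ' : AEMeasurable Z' μ'')
    (hmap : μ'.map Z = μ''.map Z') : TendstoInDistribution X l Z' (fun _ => μ) μ'' where
  forall_aemeasurable := h.forall_aemeasurable
  aemeasurable_limit := hZ'
  tendsto := by
    have h1 := h.tendsto
    have h2 : (⟨μ'.map Z, Measure.isProbabilityMeasure_map h.aemeasurable_limit⟩ :
        ProbabilityMeasure E) = ⟨μ''.map Z', Measure.isProbabilityMeasure_map hZ'⟩ :=
      Subtype.ext hmap
    rwa [h2] at h1

end LimitLaw

namespace IsHilbertBrownianMotion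

variable {H : Type*} [NormedAddCommGroup H] [InnerProductSpace ℝ H] [MeasurableSpace H]
  [CompleteSpace H] [SecondCountableTopology H] [BorelSpace H]
  {Ω : Type*} [MeasurableSpace Ω] {P : Measure Ω} {C : H →L[ℝ] H} {W : I → Ω → H}

/-- For fixed `z` in the kernel the inner product is centered with variance zero. A dense sequence
in the kernel and continuity in `z` yield one null set for all `z`. -/
theorem ae_orthogonal_ker (hW : IsHilbertBrownianMotion C W P) (hC : IsSelfAdjoint C) (t : I) :
    ∀ᵐ ω ∂P, ∀ z, C z = 0 → ⟪z, W t ω - (t : ℝ) • W 1 ω⟫ = 0 := by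
  have := hW.isGaussianProcess.isProbabilityMeasure
  have h1 : ∀ z, C z = 0 → ∀ᵐ ω ∂P, ⟪z, W t ω - (t : ℝ) • W 1 ω⟫ = 0 := fun z hz => by
    have hL : HasGaussianLaw (fun ω => ⟪z, W t ω - (t : ℝ) • W 1 ω⟫) P :=
      (hW.isGaussianProcess_inner_bridge fun _ : Unit => z).hasGaussianLaw_eval ((), t)
    have hvar : Var[fun ω => ⟪z, W t ω - (t : ℝ) • W 1 ω⟫; P] = 0 := by
      rw [← covariance_self hL.aemeasurable, hW.covariance_inner_bridge hC, hz, inner_zero_left,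
        mul_zero]
    have h := ae_eq_integral_of_variance_eq_zero hL.memLp_two hvar
    filter_upwards [h] with ω hω
    rw [hω, hW.integral_inner_bridge]
  let K := LinearMap.ker (C : H →ₗ[ℝ] H)
  have h2 : ∀ᵐ ω ∂P, ∀ n,
      ⟪(TopologicalSpace.denseSeq K n : H), W t ω - (t : ℝ) • W 1 ω⟫ = 0 :=
    ae_all_iff.2 fun n => h1 _ (TopologicalSpace.denseSeq K n).2
  filter_upwards [h2] with ω hω z hz
  have hcl : IsClosed {z : K | ⟪(z : H), W t ω - (t : ℝ) • W 1 ω⟫ = 0} :=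
    isClosed_eq (by fun_prop) continuous_const
  exact (TopologicalSpace.denseRange_denseSeq K).induction_on
    (p := fun z : K => ⟪(z : H), W t ω - (t : ℝ) • W 1 ω⟫ = 0) ⟨z, hz⟩ hcl hω

end IsHilbertBrownianMotion

/-! ### Identification of the limit law -/

section LimitLaw

variable {H : Type*} [NormedAddCommGroup H] [InnerProductSpace ℝ H] [CompleteSpace H]
  [SecondCountableTopology H] [MeasurableSpace H] [BorelSpace H]
  {Ω' : Type*} [MeasurableSpace Ω'] {P' : Measure Ω'} {Ω'' : Type*} [MeasurableSpace Ω'']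
  {Q : Measure Ω''}
  {C : H →L[ℝ] H} {lam : ℕ → ℝ} {v : ℕ → H}

/-- The normalized coordinates of the bridge of a Brownian motion are distributed like
independent Brownian bridges. -/
theorem map_coordinates_eq_map_brownianBridge (hspec : IsSpectralDecomposition C lam v)
    {W : I → Ω' → H} (hW : IsHilbertBrownianMotion C W P') {B : ℕ → I → Ω'' → ℝ}
    (hB : ∀ p, IsBrownianBridge (B p) Q) (hB_indep : iIndepFun (fun p ω t => B p t ω) Q)
    (τ : ℕ → I) :
    P'.map (fun ω (q : {p // lam p ≠ 0} × ℕ) =>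
        (√(lam q.1))⁻¹ * ⟪v q.1, W (τ q.2) ω - (τ q.2 : ℝ) • W 1 ω⟫) =
      Q.map (fun ω (q : {p // lam p ≠ 0} × ℕ) => B q.1 (τ q.2) ω) := by
  have hG1 : IsGaussianProcess (fun (q : {p // lam p ≠ 0} × ℕ) ω =>
      (√(lam q.1))⁻¹ * ⟪v q.1, W (τ q.2) ω - (τ q.2 : ℝ) • W 1 ω⟫) P' :=
    ((hW.isGaussianProcess_inner_bridge fun p : {p // lam p ≠ 0} => v p).comp_right
      fun q : {p // lam p ≠ 0} × ℕ => (q.1, τ q.2)).smul fun q => (√(lam q.1))⁻¹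
  have hG2 : IsGaussianProcess (fun (q : {p // lam p ≠ 0} × ℕ) ω => B q.1 (τ q.2) ω) Q :=
    (iIndepFun.isGaussianProcess (fun p => (hB p).gaussian) hB_indep).comp_right
      fun q : {p // lam p ≠ 0} × ℕ => ((q.1 : ℕ), τ q.2)
  refine IsGaussianProcess.map_eq_of_covariance_eq hG1 hG2 (fun q => ?_) fun q r => ?_
  · rw [integral_const_mul, hW.integral_inner_bridge, mul_zero, (hB _).centered]
  · rw [covariance_const_mul_left, covariance_const_mul_right,
      hW.covariance_inner_bridge hspec.isSelfAdjoint, hspec.apply_eq_smul q.1.2,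
      real_inner_smul_left]
    -- On the diagonal the two normalizing factors cancel `lam p`. Off it, both covariances vanish,
    -- by orthogonality of the eigenvectors and by independence of the bridges.
    rcases eq_or_ne q.1 r.1 with h | h
    · have hpos := hspec.pos q.1.2
      rw [← h, (hB q.1).covariance, real_inner_self_eq_norm_sq, hspec.norm_eq_one q.1.2]
      have h1 : (√(lam q.1))⁻¹ * ((√(lam q.1))⁻¹ * lam q.1) = 1 := by
        rw [← mul_assoc, ← mul_inv, Real.mul_self_sqrt hpos.le, inv_mul_cancel₀ hpos.ne']
      linear_combination (min (τ q.2 : ℝ) (τ r.2) - τ q.2 * τ r.2) * h1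
    · have h' : (q.1 : ℕ) ≠ r.1 := fun h0 => h (Subtype.ext h0)
      rw [hspec.inner_eq_zero q.1.2 r.1.2 h',
        covariance_of_iIndepFun (fun p => (hB p).gaussian) hB_indep h']
      simp

/-- The weight `lam p / (lam p + lam 0)` times the normalization `1 / lam p` is the eigenvalue `(lam
p + lam 0)⁻¹` of the inverse shift. Countably many times suffice, so the null sets from
orthogonality to the kernel can be united. -/
theorem seriesSup_coordinates_ae_eq [Nontrivial H] (hspec : IsSpectralDecomposition C lam v)
    (hC : C ≠ 0) {W : Ω' → SkorokhodSpace H}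
    (hW : IsHilbertBrownianMotion C (fun t ω => W ω t) P') :
    ∀ᵐ ω ∂P', seriesSup (fun p : {p // lam p ≠ 0} => lam p / (lam p + lam 0))
        (fun q => (√(lam q.1))⁻¹ * ⟪v q.1, W ω (TopologicalSpace.denseSeq I q.2) -
          (TopologicalSpace.denseSeq I q.2 : ℝ) • W ω 1⟫) =
      ENNReal.ofReal (SkorokhodSpace.bridgeSup
        (invSqrtOp (C + rayleighSup C • ContinuousLinearMap.id ℝ H)) (W ω) ^ 2) := by
  have hker := ae_all_iff.2 fun n =>
    hW.ae_orthogonal_ker hspec.isSelfAdjoint (TopologicalSpace.denseSeq I n)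
  filter_upwards [hW.continuous_paths, hker] with ω hcont hω
  rw [← SkorokhodSpace.iSup_denseSeq_ofReal_norm_sq _ hcont]
  refine iSup_congr fun n => ?_
  have hs := hspec.hasSum_norm_sq hC (hω n)
  have hnn : ∀ p : {p // lam p ≠ 0}, 0 ≤ (lam p + lam 0)⁻¹ *
      ⟪v p, W ω (TopologicalSpace.denseSeq I n) -
        (TopologicalSpace.denseSeq I n : ℝ) • W ω 1⟫ ^ 2 := fun p => by
    have := hspec.nonneg p
    have := hspec.nonneg 0
    positivity
  rw [SkorokhodSpace.bridge, ← hs.tsum_eq, ENNReal.ofReal_tsum_of_nonneg hnn hs.summable]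
  refine tsum_congr fun p => congrArg ENNReal.ofReal ?_
  have hp := hspec.pos p.2
  rw [mul_pow, inv_pow, Real.sq_sqrt hp.le]
  field_simp

end LimitLaw

end

/-! ### Assembly of the limit theorem -/

theorem mainTheorem1
    -- a real separable Hilbert space
    {H : Type*} [NormedAddCommGroup H] [InnerProductSpace ℝ H] [CompleteSpace H]
    [TopologicalSpace.SeparableSpace H] [MeasurableSpace H] [BorelSpace H]
    {Ω : Type*} [MeasurableSpace Ω] (P : Measure Ω) [IsProbabilityMeasure P]
    -- the errors: centered, strictly stationary, with a moment of order `κ > 2`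
    (ε : ℤ → Ω → H) (hε_meas : ∀ i, Measurable (ε i))
    (hε_centered : ∀ i, ∫ ω, ε i ω ∂P = 0)
    (hε_stationary : ∀ h : ℤ, IdentDistrib (fun ω i => ε (i + h) ω) (fun ω i => ε i ω) P P)
    (κ : ℝ) (hκ : 2 < κ) (hε_moment : MemLp (ε 1) (ENNReal.ofReal κ) P)
    -- the long-run covariance operator and its spectral decomposition
    (hC_summable : Summable fun r : ℤ => ‖lagCovOp P ε r‖)
    (hC_ne : longRunCovOp P ε ≠ 0)
    (lam : ℕ → ℝ) (v : ℕ → H) (hspec : IsSpectralDecomposition (longRunCovOp P ε) lam v)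
    (hcov_summable : Summable fun q : ℕ × ℤ =>
      |cov[fun ω => ⟪ε 0 ω, v q.1⟫, fun ω => ⟪ε q.2 ω, v q.1⟫; P]|)
    -- the functional central limit theorem in `D([0,1], H)`
    {Ω' : Type*} [MeasurableSpace Ω'] (P' : Measure Ω') [IsProbabilityMeasure P']
    (W : Ω' → SkorokhodSpace H)
    (hW : IsHilbertBrownianMotion (longRunCovOp P ε) (fun t ω => W ω t) P')
    (hfclt : TendstoInDistribution
      (fun (n : ℕ) ω => partialSumProcess n (fun i => ε i ω)) atTop W (fun _ => P) P')
    -- the covariance estimators, consistent in operator norm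
    (Chat : ℕ → Ω → H →L[ℝ] H) (hChat_meas : ∀ n, AEStronglyMeasurable (Chat n) P)
    (hChat_selfAdjoint : ∀ n, ∀ᵐ ω ∂P, IsSelfAdjoint (Chat n ω))
    (hChat_compact : ∀ n, ∀ᵐ ω ∂P, IsCompactOperator (Chat n ω))
    (hChat : TendstoInMeasure P Chat atTop (fun _ => longRunCovOp P ε))
    -- the observations under the null hypothesis of a constant mean
    (μ : ℕ → H) (X : ℕ → Ω → H) (hX : ∀ i ω, X i ω = μ i + ε i ω)
    (hnull : ∀ i j, 1 ≤ i → 1 ≤ j → μ i = μ j)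
    -- independent standard Brownian bridges
    {Ω'' : Type*} [MeasurableSpace Ω''] (Q : Measure Ω'') [IsProbabilityMeasure Q]
    (B : ℕ → I → Ω'' → ℝ) (hB : ∀ p, IsBrownianBridge (B p) Q)
    (hB_indep : iIndepFun (fun p ω t => B p t ω) Q) :
    -- the limit variable is almost surely well defined and finite
    (∀ᵐ ω ∂Q, (∀ t : I, Summable fun p => lam p / (lam p + lam 0) * B p t ω ^ 2) ∧
      BddAbove (range fun t : I => ∑' p, lam p / (lam p + lam 0) * B p t ω ^ 2)) ∧
    -- and it is the limit in distribution of the squared statistic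
    TendstoInDistribution
      (fun (n : ℕ) ω => weightedStatistic (Chat n ω) n (fun i => X i ω) ^ 2) atTop
      (fun ω => ⨆ t : I, ∑' p, lam p / (lam p + lam 0) * B p t ω ^ 2) (fun _ => P) Q := by
  have hsc : SecondCountableTopology H := UniformSpace.secondCountable_of_separable H
  set C := longRunCovOp P ε with hCdef
  have hnt : Nontrivial H := by
    by_contra h
    rw [not_nontrivial_iff_subsingleton] at h
    exact hC_ne (Subsingleton.elim _ _)
  set R := invSqrtOp (C + rayleighSup C • ContinuousLinearMap.id ℝ H) with hR
  set τ := TopologicalSpace.denseSeq I with hτ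
  set a : ℕ → ℝ := fun p => lam p / (lam p + lam 0) with ha
  have ha0 : ∀ p, 0 ≤ a p := fun p =>
    div_nonneg (hspec.nonneg p) (add_nonneg (hspec.nonneg p) (hspec.nonneg 0))
  let F : ({p // lam p ≠ 0} × ℕ → ℝ) → ℝ≥0∞ := seriesSup fun p : {p // lam p ≠ 0} => a p
  have hF : Measurable F := measurable_seriesSup _
  let Y : Ω' → {p // lam p ≠ 0} × ℕ → ℝ := fun ω q =>
    (√(lam q.1))⁻¹ * ⟪v q.1, W ω (τ q.2) - (τ q.2 : ℝ) • W ω 1⟫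
  let Z : Ω'' → {p // lam p ≠ 0} × ℕ → ℝ := fun ω q => B q.1 (τ q.2) ω
  have hmap : P'.map Y = Q.map Z :=
    map_coordinates_eq_map_brownianBridge hspec hW hB hB_indep τ
  have hZ : Measurable Z := measurable_pi_lambda _ fun q => (hB q.1).measurable _
  have hY : AEMeasurable Y P' := by
    -- `Measure.map` is zero for a map that is not a.e. measurable. Here it equals a probability
    -- measure, so measurability of the evaluations of `W` need not be examined.
    refine AEMeasurable.of_map_ne_zero ?_
    rw [hmap]
    have : IsProbabilityMeasure (Q.map Z) := Measure.isProbabilityMeasure_map hZ.aemeasurable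
    exact this.ne_zero
  have hFY : ∀ᵐ ω ∂P', F (Y ω) = ENNReal.ofReal (SkorokhodSpace.bridgeSup R (W ω) ^ 2) :=
    seriesSup_coordinates_ae_eq hspec hC_ne hW
  -- Finiteness is clear for `Y`, where `F` is the square of a real supremum, and passes to the
  -- bridges through the equality of laws.
  have hFZ : ∀ᵐ ω ∂Q, F (Z ω) ≠ ∞ := by
    have h1 : ∀ᵐ y ∂(P'.map Y), F y ≠ ∞ := by
      refine (ae_map_iff hY (p := fun y => F y ≠ ∞) (hF (measurableSet_singleton ∞).compl)).2 ?_
      filter_upwards [hFY] with ω hω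
      rw [hω]
      exact ENNReal.ofReal_ne_top
    rw [hmap] at h1
    exact ae_of_ae_map hZ.aemeasurable h1
  have hFZ_eq : ∀ ω, F (Z ω) = seriesSup a fun q => B q.1 (τ q.2) ω := fun ω =>
    seriesSup_subtype (s := {p | lam p ≠ 0})
      (fun p hp => by rw [ha]; simp [not_not.1 hp]) fun q => B q.1 (τ q.2) ω
  have hlim : ∀ᵐ ω ∂Q, (∀ t, Summable fun p => a p * B p t ω ^ 2) ∧
      BddAbove (range fun t : I => ∑' p, a p * B p t ω ^ 2) ∧
      ⨆ t : I, ∑' p, a p * B p t ω ^ 2 = (F (Z ω)).toReal := by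
    filter_upwards [hFZ, ae_all_iff.2 fun p => (hB p).continuous_paths] with ω h1 h2
    rw [hFZ_eq] at h1 ⊢
    exact toReal_seriesSup_of_continuous ha0 h2 h1
  refine ⟨hlim.mono fun ω h => ⟨h.1, h.2.1⟩, ?_⟩
  have hXm : ∀ i, Measurable (X i) := fun i => by
    rw [show X i = fun ω => μ i + ε i ω from funext (hX i)]
    exact (hε_meas i).const_add _
  have hstat := tendstoInDistribution_weightedStatistic hfclt hspec.isSelfAdjoint
    (hspec.mem_coerciveShiftSet hC_ne) hChat_meas hChat_selfAdjoint hChat_compact hChat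
    hXm (m := μ 1) (fun i hi ω => by rw [hX, hnull i 1 hi le_rfl]) hR
  have hsq : TendstoInDistribution
      (fun (n : ℕ) ω => weightedStatistic (Chat n ω) n (fun i => X i ω) ^ 2) atTop
      (fun ω => SkorokhodSpace.bridgeSup R (W ω) ^ 2) (fun _ => P) P' := by
    have h := hstat.continuous_comp (g := fun r : ℝ => r ^ 2) (by fun_prop)
    exact h
  have hFr : Measurable fun y => (F y).toReal := hF.ennreal_toReal
  have hlimZ : (fun ω => (F (Z ω)).toReal) =ᵐ[Q] fun ω => ⨆ t : I, ∑' p, a p * B p t ω ^ 2 :=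
    hlim.mono fun ω h => h.2.2.symm
  refine TendstoInDistribution.of_map_eq hsq ((hFr.comp hZ).aemeasurable.congr hlimZ) ?_
  have h1 : (fun ω => SkorokhodSpace.bridgeSup R (W ω) ^ 2) =ᵐ[P'] fun ω => (F (Y ω)).toReal := by
    filter_upwards [hFY] with ω hω
    rw [hω, ENNReal.toReal_ofReal (sq_nonneg _)]
  have h2 := AEMeasurable.map_map_of_aemeasurable (μ := P') hFr.aemeasurable hY
  have h3 := AEMeasurable.map_map_of_aemeasurable (μ := Q) hFr.aemeasurable hZ.aemeasurable
  rw [Measure.map_congr h1, ← Measure.map_congr hlimZ]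
  calc P'.map (fun ω => (F (Y ω)).toReal) = (P'.map Y).map fun y => (F y).toReal := h2.symm
    _ = (Q.map Z).map fun y => (F y).toReal := by rw [hmap]
    _ = _ := h3
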